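/- Let $\zeta$ be the Riemann zeta function and let $c$ be Euler's constant. Let $N\ge 1$ be an integer and let $\epsilon>0$. For every quadruple of positive integers $x,y,z,n$ with $n\ge 3$ and $$\frac{x^n+y^n}{z^n}\in\left(1-\frac{\epsilon}{N},\,1+\frac{\epsilon}{N}\right),$$ the finite limit $$\Lambda_N(x,y,z,n)=\lim_{\tau\to\infty}\frac1\tau\int_{\frac{x^n+y^n}{z^n}\frac{\tau}{\ln 2\pi-2c}}^{(N+1)\frac{x^n+y^n}{z^n}\frac{\tau}{\ln 2\pi-2c}}\left\{\ln t-\left|\zeta\left(\tfrac12+it\right)\right|^2\right\}\,dt$$ exists, and the condition that $\Lambda_N(x,y,z,n)\neq N$ for all such quadruples is equivalent to the Fermat--Wiles theorem, that is, to the assertion that $x^n+y^n\neq z^n$ for all positive integers $x,y,z,n$ with $n\ge 3$. -/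

import Mathlib

open Filter Topology

/-- The integrand of the logarithmic modification of the Hardy-Littlewood integral,
`ln t - |ζ(1/2 + it)|²`. -/
noncomputable def logModIntegrand (t : ℝ) : ℝ :=
  Real.log t - ‖riemannZeta (1 / 2 + (t : ℂ) * Complex.I)‖ ^ 2

/-- The constant `ln 2π - 2c`, with `c` Euler's constant. -/
noncomputable def logModConst : ℝ :=
  Real.log (2 * Real.pi) - 2 * Real.eulerMascheroniConstant

/-- The Fermat rational `(xⁿ + yⁿ) / zⁿ`. -/
noncomputable def fermatRational (x y z n : ℕ) : ℝ :=
  ((x : ℝ) ^ n + (y : ℝ) ^ n) / (z : ℝ) ^ n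

/-- The normalized integral of `ln t - |ζ(1/2 + it)|²` over the interval from
`q τ / (ln 2π - 2c)` to `(N + 1) q τ / (ln 2π - 2c)`, as a function of `τ`. -/
noncomputable def logModMean (N : ℕ) (q τ : ℝ) : ℝ :=
  (1 / τ) * ∫ t in (q * (τ / logModConst))..(((N : ℝ) + 1) * q * (τ / logModConst)),
    logModIntegrand t

/-- `(x, y, z, n)` are positive integers with `n ≥ 3` whose Fermat rational lies in the
open interval `(1 - ε / N, 1 + ε / N)`. -/
def LocalFermat (N : ℕ) (ε : ℝ) (x y z n : ℕ) : Prop :=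
  0 < x ∧ 0 < y ∧ 0 < z ∧ 3 ≤ n ∧
    fermatRational x y z n ∈ Set.Ioo (1 - ε / (N : ℝ)) (1 + ε / (N : ℝ))

/-! Everything rests on the mean square with its second term, `tendsto_mean_square_riemannZeta`: the
integral of |ζ(1/2 + it)|² over [1, T] is T log T + (2c - 1 - log 2π) T + o(T). Subtracting it from
the integral of log t leaves (log 2π - 2c) T + o(T), so with q the Fermat rational the endpoints in
Λ_N are scaled to give exactly N q (`tendsto_logModMean`). Hence Λ_N = N precisely when q = 1, that
is, at a solution of Fermat's equation; Fermat's theorem itself is not used.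

The mean square comes from comparing two positive measures, |ζ(1/2 + it)|² dt and the measure with
mass 2π d(n) at 2πn, where d is the divisor function. The functional equation turns |ζ|² e^{-δt} on
the critical line into ζ(s)² times a Gamma kernel. Moving the line to Re s = 3/2 and expanding ζ²
gives 2π ∑ d(n) exp(-2πi n e^{-iδ}) up to O(1) (`exists_laplace_sub_rotatedSeries_bound`). Since
e^{2πin} = 1, this is close to 2π ∑ d(n) e^{-2πnδ}, the Laplace transform of the second measure.

The comparison is made for complex δ, with a power saving
(`exists_norm_zetaLaplace_sub_lambertSeries_le`). Perron's formula with a double pole therefore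
compares the integrated distribution functions, and monotonicity removes the integration
(`tendsto_sublevel_of_laplace_close`). Dirichlet's hyperbola method (`tendsto_card_lambertPairs`)
evaluates the second distribution function. -/

/-! ### Continuation of ζ to Re s > 0 by a series, and its linear growth -/

/-- The `n`-th term `n⁻ˢ - ∫_n^{n+1} x⁻ˢ dx` of the series for `ζ(s) - 1/(s-1)`, shifted by one. -/
noncomputable def zetaTerm (n : ℕ) (s : ℂ) : ℂ :=
  ((n : ℂ) + 1) ^ (-s) - (((n : ℂ) + 2) ^ (1 - s) - ((n : ℂ) + 1) ^ (1 - s)) / (1 - s)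

lemma zetaTerm_eq_integral (n : ℕ) {s : ℂ} (hs : s ≠ 1) :
    zetaTerm n s = ∫ x in ((n : ℝ) + 1)..((n : ℝ) + 2),
      (((n : ℂ) + 1) ^ (-s) - (x : ℂ) ^ (-s)) := by
  have h0 : (0 : ℝ) ∉ Set.uIcc ((n : ℝ) + 1) ((n : ℝ) + 2) := by
    rw [Set.uIcc_of_le (by linarith)]
    intro h
    have := h.1
    have : (0 : ℝ) ≤ n := n.cast_nonneg
    linarith
  have hs' : -s ≠ -1 := fun h => hs (by simpa using h)
  rw [intervalIntegral.integral_sub (by simp) ?_, integral_cpow (Or.inr ⟨hs', h0⟩)]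
  · simp only [zetaTerm, intervalIntegral.integral_const]
    push_cast
    rw [show -s + 1 = 1 - s by ring]
    norm_num
  · exact intervalIntegral.intervalIntegrable_cpow (Or.inr h0)

/-- The mean value inequality on a unit interval, with derivative -s x^{-s-1}. The power gained over
(n + 1)^{-s} makes the series converge for Re s > 0. -/
lemma norm_zetaTerm_le (n : ℕ) {s : ℂ} (hs : s ≠ 1) (h0 : 0 < s.re) :
    ‖zetaTerm n s‖ ≤ ‖s‖ * ((n : ℝ) + 1) ^ (-s.re - 1) := by
  rw [zetaTerm_eq_integral n hs]
  have hn : (0 : ℝ) ≤ n := n.cast_nonneg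
  have hle : (n : ℝ) + 1 ≤ n + 2 := by linarith
  have key : ∀ x ∈ Set.Icc ((n : ℝ) + 1) ((n : ℝ) + 2),
      ‖(x : ℂ) ^ (-s) - (((n : ℝ) + 1 : ℝ) : ℂ) ^ (-s)‖ ≤
        (‖s‖ * ((n : ℝ) + 1) ^ (-s.re - 1)) * (x - (n + 1)) := by
    refine norm_image_sub_le_of_norm_deriv_le_segment'
      (f' := fun x : ℝ => -s * (x : ℂ) ^ (-s - 1)) ?_ ?_
    · intro x hx
      have hx0 : (0 : ℝ) < x := by linarith [hx.1]
      have hs0 : s ≠ 0 := by rintro rfl; simp at h0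
      exact (hasDerivAt_ofReal_cpow_const hx0.ne' (neg_ne_zero.mpr hs0)).hasDerivWithinAt
    · intro x hx
      have hx0 : (0 : ℝ) < x := by linarith [hx.1]
      rw [norm_mul, norm_neg, Complex.norm_cpow_eq_rpow_re_of_pos hx0]
      simp only [Complex.sub_re, Complex.neg_re, Complex.one_re]
      gcongr ?_ * ?_
      exact Real.rpow_le_rpow_of_nonpos (by linarith) hx.1 (by linarith)
  have := intervalIntegral.norm_integral_le_of_norm_le_const
    (f := fun x : ℝ => (((n : ℂ) + 1) ^ (-s) - (x : ℂ) ^ (-s))) (a := (n : ℝ) + 1) (b := (n : ℝ) + 2)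
    (C := ‖s‖ * ((n : ℝ) + 1) ^ (-s.re - 1)) ?_
  · refine this.trans (le_of_eq ?_)
    rw [show (n : ℝ) + 2 - (n + 1) = 1 by ring]
    simp
  · intro x hx
    rw [Set.uIoc_of_le hle] at hx
    rw [norm_sub_rev]
    have := key x ⟨hx.1.le, hx.2⟩
    push_cast at this
    refine this.trans (mul_le_of_le_one_right (by positivity) (by linarith [hx.2]))

lemma summable_nat_add_one_rpow {a : ℝ} (ha : 1 < a) :
    Summable fun n : ℕ => ((n : ℝ) + 1) ^ (-a) := by
  have := (summable_nat_add_iff (f := fun n : ℕ => (n : ℝ) ^ (-a)) 1).mpr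
    (Real.summable_nat_rpow.mpr (by linarith))
  simpa using this

lemma differentiableAt_zetaTerm (n : ℕ) {s : ℂ} (hs : s ≠ 1) :
    DifferentiableAt ℂ (zetaTerm n) s := by
  have h1 : ((n : ℂ) + 1) ≠ 0 := by exact_mod_cast n.succ_ne_zero
  have h2 : ((n : ℂ) + 2) ≠ 0 := by exact_mod_cast (n + 1).succ_ne_zero
  have h3 : 1 - s ≠ 0 := sub_ne_zero.mpr hs.symm
  unfold zetaTerm
  refine DifferentiableAt.sub ?_ (DifferentiableAt.div (DifferentiableAt.sub ?_ ?_) (by fun_prop) h3)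
  · exact DifferentiableAt.const_cpow (by fun_prop) (Or.inl h1)
  · exact DifferentiableAt.const_cpow (by fun_prop) (Or.inl h2)
  · exact DifferentiableAt.const_cpow (by fun_prop) (Or.inl h1)

lemma differentiableOn_tsum_zetaTerm :
    DifferentiableOn ℂ (fun s => ∑' n, zetaTerm n s) {s : ℂ | 0 < s.re ∧ 0 < s.im} := by
  have hopen : IsOpen {s : ℂ | 0 < s.re ∧ 0 < s.im} :=
    (isOpen_lt continuous_const Complex.continuous_re).inter
      (isOpen_lt continuous_const Complex.continuous_im)
  intro s hs
  -- On V the real part stays away from 0 and the norm is bounded, so one summable majorant serves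
  -- for all terms.
  set V : Set ℂ := {z : ℂ | s.re / 2 < z.re ∧ 0 < z.im ∧ ‖z‖ < ‖s‖ + 1}
  have hV : IsOpen V := (isOpen_lt continuous_const Complex.continuous_re).inter
    ((isOpen_lt continuous_const Complex.continuous_im).inter
      (isOpen_lt continuous_norm continuous_const))
  have hsV : s ∈ V := ⟨by linarith [hs.1], hs.2, by linarith⟩
  have hne : ∀ z ∈ V, z ≠ 1 := by
    rintro z hz rfl
    simpa using hz.2.1
  have : DifferentiableOn ℂ (fun s => ∑' n, zetaTerm n s) V := by
    refine Complex.differentiableOn_tsum_of_summable_norm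
      (u := fun n : ℕ => (‖s‖ + 1) * ((n : ℝ) + 1) ^ (-(s.re / 2 + 1))) ?_ ?_ hV ?_
    · exact (summable_nat_add_one_rpow (by linarith [hs.1])).mul_left _
    · exact fun n z hz => (differentiableAt_zetaTerm n (hne z hz)).differentiableWithinAt
    · intro n z hz
      have hz0 : 0 < z.re := by linarith [hz.1, hs.1]
      refine (norm_zetaTerm_le n (hne z hz) hz0).trans ?_
      have hn : (0 : ℝ) ≤ n := n.cast_nonneg
      gcongr
      · exact hz.2.2.le
      · linarith
      · linarith [hz.1]
  exact (this.differentiableAt (hV.mem_nhds hsV)).differentiableWithinAt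

/-- The subtracted integrals telescope, and the boundary term (N + 1)^{1-s} tends to 0 when Re s >
1. -/
lemma tsum_zetaTerm_of_one_lt_re {s : ℂ} (hs : 1 < s.re) :
    riemannZeta s = 1 / (s - 1) + ∑' n, zetaTerm n s := by
  have hs1 : s ≠ 1 := by rintro rfl; simp at hs
  have h3 : 1 - s ≠ 0 := sub_ne_zero.mpr hs1.symm
  have h3' : s - 1 ≠ 0 := sub_ne_zero.mpr hs1
  have hsum : Summable fun n => zetaTerm n s := by
    refine Summable.of_norm_bounded (g := fun n : ℕ => ‖s‖ * ((n : ℝ) + 1) ^ (-(s.re + 1)))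
      ((summable_nat_add_one_rpow (by linarith)).mul_left _) fun n => ?_
    have := norm_zetaTerm_le n hs1 (by linarith)
    rwa [show -s.re - 1 = -(s.re + 1) by ring] at this
  have hz : HasSum (fun n : ℕ => 1 / ((n : ℂ) + 1) ^ s) (riemannZeta s) := by
    rw [zeta_eq_tsum_one_div_nat_add_one_cpow hs]
    refine Summable.hasSum ?_
    have := (summable_nat_add_iff 1).mpr (Complex.summable_one_div_nat_cpow.mpr hs)
    simpa using this
  have h1 := hz.tendsto_sum_nat
  have h2 := hsum.hasSum.tendsto_sum_nat
  have hfin : ∀ N : ℕ, ∑ n ∈ Finset.range N, zetaTerm n s =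
      ∑ n ∈ Finset.range N, 1 / ((n : ℂ) + 1) ^ s - (((N : ℂ) + 1) ^ (1 - s) - 1) / (1 - s) := by
    intro N
    induction N with
    | zero => simp
    | succ N ih =>
      rw [Finset.sum_range_succ, Finset.sum_range_succ, ih, zetaTerm, Complex.cpow_neg]
      push_cast
      rw [show (N : ℂ) + 1 + 1 = N + 2 by ring]
      ring
  have h4 : Tendsto (fun N : ℕ => ((N : ℂ) + 1) ^ (1 - s)) atTop (𝓝 0) := by
    rw [tendsto_zero_iff_norm_tendsto_zero]
    have : ∀ N : ℕ, ‖((N : ℂ) + 1) ^ (1 - s)‖ = ((N : ℝ) + 1) ^ (-(s.re - 1)) := by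
      intro N
      have := Complex.norm_cpow_eq_rpow_re_of_pos (x := (N : ℝ) + 1) (by positivity) (1 - s)
      push_cast at this
      rw [this]
      simp
    simp_rw [this]
    exact (tendsto_rpow_neg_atTop (by linarith)).comp
      (tendsto_atTop_add_const_right _ _ tendsto_natCast_atTop_atTop)
  simp_rw [hfin] at h2
  have h5 := h1.sub (((h4.sub_const 1)).div_const (1 - s))
  have := tendsto_nhds_unique h2 h5
  rw [this]
  field_simp
  ring

/-- The identity theorem on the open first quadrant, which is convex, avoids the pole at 1 and meets
Re s > 1. -/
lemma riemannZeta_eq_tsum_zetaTerm {s : ℂ} (h0 : 0 < s.re) (h1 : 0 < s.im) :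
    riemannZeta s = 1 / (s - 1) + ∑' n, zetaTerm n s := by
  have hopen : IsOpen {s : ℂ | 0 < s.re ∧ 0 < s.im} :=
    (isOpen_lt continuous_const Complex.continuous_re).inter
      (isOpen_lt continuous_const Complex.continuous_im)
  have hne : ∀ z ∈ {s : ℂ | 0 < s.re ∧ 0 < s.im}, z ≠ 1 := by
    rintro z hz rfl
    simpa using hz.2
  have hconv : Convex ℝ {s : ℂ | 0 < s.re ∧ 0 < s.im} :=
    (convex_halfSpace_re_gt 0).inter (convex_halfSpace_im_gt 0)
  have hA : AnalyticOnNhd ℂ riemannZeta {s : ℂ | 0 < s.re ∧ 0 < s.im} :=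
    DifferentiableOn.analyticOnNhd
      (fun z hz => (differentiableAt_riemannZeta (hne z hz)).differentiableWithinAt) hopen
  have hB : AnalyticOnNhd ℂ (fun s => 1 / (s - 1) + ∑' n, zetaTerm n s)
      {s : ℂ | 0 < s.re ∧ 0 < s.im} := by
    refine DifferentiableOn.analyticOnNhd (DifferentiableOn.add ?_ differentiableOn_tsum_zetaTerm)
      hopen
    exact DifferentiableOn.div (by fun_prop) (by fun_prop) fun z hz => sub_ne_zero.mpr (hne z hz)
  refine hA.eqOn_of_preconnected_of_eventuallyEq hB hconv.isPreconnected
    (z₀ := 2 + Complex.I) (by simp) ?_ ⟨h0, h1⟩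
  have : {z : ℂ | 1 < z.re} ∈ 𝓝 (2 + Complex.I) :=
    (isOpen_lt continuous_const Complex.continuous_re).mem_nhds (by simp)
  filter_upwards [this] with z hz using tsum_zetaTerm_of_one_lt_re hz

/-- Linear growth of `ζ` to the right of the critical line. -/
theorem exists_norm_riemannZeta_le :
    ∃ C : ℝ, 0 ≤ C ∧ ∀ s : ℂ, 1 / 2 ≤ s.re → 1 ≤ s.im → ‖riemannZeta s‖ ≤ C * ‖s‖ := by
  have hS := summable_nat_add_one_rpow (a := 3 / 2) (by norm_num)
  refine ⟨1 + ∑' n : ℕ, ((n : ℝ) + 1) ^ (-(3 / 2) : ℝ),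
    add_nonneg zero_le_one (tsum_nonneg fun n => by positivity), fun s h0 h1 => ?_⟩
  have hs1 : s ≠ 1 := by rintro rfl; norm_num at h1
  have him : 1 ≤ ‖s‖ := h1.trans ((le_abs_self _).trans (Complex.abs_im_le_norm s))
  rw [riemannZeta_eq_tsum_zetaTerm (by linarith) (by linarith), add_mul]
  refine (norm_add_le _ _).trans (add_le_add ?_ ?_)
  · have : 1 ≤ ‖s - 1‖ := by
      have := (le_abs_self _).trans (Complex.abs_im_le_norm (s - 1))
      simp at this
      linarith
    rw [norm_div, norm_one, one_mul]
    exact (div_le_one_of_le₀ this (norm_nonneg _)).trans him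
  · rw [mul_comm, ← tsum_mul_left]
    refine tsum_of_norm_bounded (hS.mul_left _).hasSum fun n => ?_
    refine (norm_zetaTerm_le n hs1 (by linarith)).trans ?_
    have hn : (0 : ℝ) ≤ n := n.cast_nonneg
    gcongr
    · linarith
    · linarith

/-! ### Euler's integral with a complex parameter -/

open MeasureTheory Set in
lemma integrableOn_cpow_mul_cexp_neg_mul {s w : ℂ} (hs : 0 < s.re) (hw : 0 < w.re) :
    IntegrableOn (fun x : ℝ => (x : ℂ) ^ (s - 1) * Complex.exp (-(w * x))) (Ioi 0) := by
  have h := integrableOn_rpow_mul_exp_neg_mul_rpow (p := 1) (s := s.re - 1) (b := w.re)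
    (by linarith) one_pos hw
  refine h.mono' ?_ ?_
  · refine ContinuousOn.aestronglyMeasurable (fun x hx => ?_) measurableSet_Ioi
    refine ContinuousAt.continuousWithinAt (ContinuousAt.mul ?_ (by fun_prop))
    exact Complex.continuousAt_ofReal_cpow_const _ _ (Or.inr (ne_of_gt hx))
  · refine (ae_restrict_iff' measurableSet_Ioi).mpr (Eventually.of_forall fun x hx => ?_)
    rw [norm_mul, Complex.norm_cpow_eq_rpow_re_of_pos hx, Complex.norm_exp]
    simp

open MeasureTheory Set in
lemma differentiableAt_integral_cpow_mul_cexp {s w : ℂ} (hs : 0 < s.re) (hw : 0 < w.re) :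
    DifferentiableAt ℂ
      (fun w : ℂ => ∫ x in Ioi (0 : ℝ), (x : ℂ) ^ (s - 1) * Complex.exp (-(w * x))) w := by
  have hU : {z : ℂ | w.re / 2 < z.re} ∈ 𝓝 w :=
    (isOpen_lt continuous_const Complex.continuous_re).mem_nhds (by simp; linarith)
  have key := hasDerivAt_integral_of_dominated_loc_of_deriv_le
    (μ := volume.restrict (Ioi (0 : ℝ))) (𝕜 := ℂ)
    (F := fun (w : ℂ) (x : ℝ) => (x : ℂ) ^ (s - 1) * Complex.exp (-(w * x)))
    (F' := fun (w : ℂ) (x : ℝ) => -((x : ℂ) ^ (s + 1 - 1) * Complex.exp (-(w * x))))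
    -- Differentiation brings down a factor x; the decay rate is halved to hold on a whole
    -- neighbourhood of w.
    (bound := fun x : ℝ => x ^ s.re * Real.exp (-(w.re / 2) * x ^ (1 : ℝ))) hU ?_ ?_ ?_ ?_ ?_ ?_
  · exact key.2.differentiableAt
  · filter_upwards [hU] with z hz
    exact (integrableOn_cpow_mul_cexp_neg_mul hs (by
      have : w.re / 2 < z.re := hz
      linarith)).aestronglyMeasurable
  · exact integrableOn_cpow_mul_cexp_neg_mul hs hw
  · exact (integrableOn_cpow_mul_cexp_neg_mul (s := s + 1) (by simp; linarith)
      hw).aestronglyMeasurable.neg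
  · refine (ae_restrict_iff' measurableSet_Ioi).mpr (Eventually.of_forall fun x hx z hz => ?_)
    have hx' : (0 : ℝ) < x := hx
    rw [norm_neg, norm_mul, Complex.norm_cpow_eq_rpow_re_of_pos hx, Complex.norm_exp]
    have hz' : w.re / 2 < z.re := hz
    simp only [add_sub_cancel_right, Complex.neg_re, Complex.re_mul_ofReal, Real.rpow_one]
    gcongr
    nlinarith
  · exact integrableOn_rpow_mul_exp_neg_mul_rpow (by linarith) one_pos (by linarith)
  · refine (ae_restrict_iff' measurableSet_Ioi).mpr (Eventually.of_forall fun x hx z _ => ?_)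
    have hx0 : (x : ℂ) ≠ 0 := by exact_mod_cast (ne_of_gt (show (0 : ℝ) < x from hx))
    have h1 : HasDerivAt (fun z : ℂ => -(z * x)) (-(1 * (x : ℂ))) z :=
      ((hasDerivAt_id z).mul_const _).neg
    refine (h1.cexp.const_mul ((x : ℂ) ^ (s - 1))).congr_deriv ?_
    rw [show s + 1 - 1 = s - 1 + 1 by ring, Complex.cpow_add _ _ hx0, Complex.cpow_one]
    ring

open MeasureTheory Set in
/-- Euler's integral for `Γ`, rotated by a complex parameter in the right half-plane. -/
theorem integral_cpow_mul_cexp_neg_mul {s w : ℂ} (hs : 0 < s.re) (hw : 0 < w.re) :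
    ∫ x in Ioi (0 : ℝ), (x : ℂ) ^ (s - 1) * Complex.exp (-(w * x)) =
      w ^ (-s) * Complex.Gamma s := by
  have hopen : IsOpen {w : ℂ | 0 < w.re} := isOpen_lt continuous_const Complex.continuous_re
  have hA : AnalyticOnNhd ℂ
      (fun w : ℂ => ∫ x in Ioi (0 : ℝ), (x : ℂ) ^ (s - 1) * Complex.exp (-(w * x)))
      {w : ℂ | 0 < w.re} :=
    DifferentiableOn.analyticOnNhd
      (fun z hz => (differentiableAt_integral_cpow_mul_cexp hs hz).differentiableWithinAt) hopen
  have hB : AnalyticOnNhd ℂ (fun w : ℂ => w ^ (-s) * Complex.Gamma s) {w : ℂ | 0 < w.re} := by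
    refine DifferentiableOn.analyticOnNhd (fun z hz => ?_) hopen
    exact ((differentiableAt_id.cpow_const (Or.inl hz)).mul_const _).differentiableWithinAt
  -- Both sides are holomorphic in w and agree at the real points 1 + 1/(n + 1), which accumulate at
  -- 1.
  refine hA.eqOn_of_preconnected_of_frequently_eq hB (convex_halfSpace_re_gt 0).isPreconnected
    (z₀ := 1) (by simp) ?_ hw
  have htend : Tendsto (fun n : ℕ => (1 : ℂ) + (1 / ((n : ℝ) + 1) : ℝ)) atTop (𝓝[≠] 1) := by
    refine tendsto_nhdsWithin_iff.mpr ⟨?_, Eventually.of_forall fun n => ?_⟩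
    · have : Tendsto (fun n : ℕ => ((1 / ((n : ℝ) + 1) : ℝ) : ℂ)) atTop (𝓝 ((0 : ℝ) : ℂ)) :=
        (Complex.continuous_ofReal.tendsto 0).comp tendsto_one_div_add_atTop_nhds_zero_nat
      simpa using this.const_add 1
    · have : (1 / ((n : ℝ) + 1) : ℝ) ≠ 0 := by positivity
      have h2 : ((1 / ((n : ℝ) + 1) : ℝ) : ℂ) ≠ 0 := by exact_mod_cast this
      simpa using h2
  refine htend.frequently (Eventually.frequently (Eventually.of_forall fun n => ?_))
  have hr : (0 : ℝ) < 1 + 1 / ((n : ℝ) + 1) := by positivity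
  have := Complex.integral_cpow_mul_exp_neg_mul_Ioi hs hr
  push_cast at this ⊢
  rw [this, one_div, Complex.inv_cpow, Complex.cpow_neg]
  have : ((1 : ℂ) + 1 / ((n : ℂ) + 1)) = ((1 + 1 / ((n : ℝ) + 1) : ℝ) : ℂ) := by push_cast; rfl
  rw [this, Complex.arg_ofReal_of_nonneg hr.le]
  exact Real.pi_pos.ne

/-! ### Perron's formula with a double pole -/

lemma norm_add_mul_I_eq (σ u : ℝ) (hσ : 0 < σ) :
    ‖(σ : ℂ) + u * Complex.I‖ = σ * (1 + ‖u / σ‖ ^ 2) ^ ((1 : ℝ) / 2) := by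
  rw [Complex.norm_add_mul_I, ← Real.sqrt_eq_rpow, ← Real.sqrt_sq hσ.le, ← Real.sqrt_mul (by positivity),
    Real.sqrt_sq hσ.le, Real.norm_eq_abs, sq_abs]
  congr 1
  field_simp

lemma norm_rpow_add_mul_I_eq (σ u : ℝ) (hσ : 0 < σ) (r : ℝ) :
    ‖(σ : ℂ) + u * Complex.I‖ ^ (-r) = σ ^ (-r) * (1 + ‖u / σ‖ ^ 2) ^ (-r / 2) := by
  rw [norm_add_mul_I_eq σ u hσ, Real.mul_rpow hσ.le (by positivity), ← Real.rpow_mul (by positivity)]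
  ring_nf

open MeasureTheory in
lemma integrable_norm_rpow_add_mul_I {σ r : ℝ} (hσ : 0 < σ) (hr : 1 < r) :
    Integrable fun u : ℝ => ‖(σ : ℂ) + u * Complex.I‖ ^ (-r) := by
  simp_rw [norm_rpow_add_mul_I_eq σ _ hσ r]
  refine Integrable.const_mul ?_ _
  exact (integrable_rpow_neg_one_add_norm_sq (E := ℝ) (r := r) (μ := volume)
    (by simpa using hr)).comp_div hσ.ne'

-- The substitution u = σv. The factor σ^{1-r} later contributes to the power of T in the Tauberian
-- estimate.
open MeasureTheory in
lemma integral_norm_rpow_add_mul_I {σ : ℝ} (r : ℝ) (hσ : 0 < σ) :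
    ∫ u : ℝ, ‖(σ : ℂ) + u * Complex.I‖ ^ (-r) =
      σ ^ (1 - r) * ∫ u : ℝ, (1 + ‖u‖ ^ 2) ^ (-r / 2) := by
  simp_rw [norm_rpow_add_mul_I_eq σ _ hσ r]
  rw [integral_const_mul, Measure.integral_comp_div (fun u : ℝ => (1 + ‖u‖ ^ 2) ^ (-r / 2)) σ,
    abs_of_pos hσ, smul_eq_mul, ← mul_assoc]
  congr 1
  rw [sub_eq_add_neg, Real.rpow_add hσ, Real.rpow_one, mul_comm]

lemma add_mul_I_ne_zero {σ : ℝ} (hσ : 0 < σ) (u : ℝ) : (σ : ℂ) + u * Complex.I ≠ 0 := by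
  intro h
  have := congrArg Complex.re h
  simp at this
  exact hσ.ne' this

open MeasureTheory Set FourierTransform in
/-- The Perron-type integral with a double pole. -/
theorem integral_cexp_div_sq {σ : ℝ} (hσ : 0 < σ) (y : ℝ) :
    ∫ u : ℝ, Complex.exp ((σ + u * Complex.I) * y) / (σ + u * Complex.I) ^ 2 =
      2 * Real.pi * (max y 0 : ℝ) := by
  -- By Euler's integral at s = 2, the Fourier transform of g is (σ + 2πiξ)⁻². It is integrable and
  -- g is continuous, so Fourier inversion holds at every point.
  set g : ℝ → ℂ := fun x => ((max x 0 * Real.exp (-(σ * x)) : ℝ) : ℂ) with hg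
  have hgc : Continuous g := by
    refine Complex.continuous_ofReal.comp ?_
    exact (continuous_id.max continuous_const).mul (by fun_prop)
  have hg0 : ∀ x ∉ Ioi (0 : ℝ), g x = 0 := by
    intro x hx
    have : max x 0 = 0 := max_eq_right (not_lt.mp hx)
    simp [hg, this]
  have hgpos : ∀ x ∈ Ioi (0 : ℝ), g x = (x : ℂ) ^ ((2 : ℂ) - 1) * Complex.exp (-((σ : ℂ) * x)) := by
    intro x hx
    have : max x 0 = x := max_eq_left (le_of_lt hx)
    simp only [hg, this]
    rw [show (2 : ℂ) - 1 = 1 by norm_num, Complex.cpow_one]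
    push_cast
    rfl
  have hgi : Integrable g := by
    have h := integrableOn_cpow_mul_cexp_neg_mul (s := 2) (w := σ) (by simp) (by simpa using hσ)
    have h2 : IntegrableOn g (Ioi 0) := h.congr_fun (fun x hx => (hgpos x hx).symm) measurableSet_Ioi
    exact (integrableOn_iff_integrable_of_support_subset (by
      intro x hx
      by_contra h
      exact hx (hg0 x h))).mp h2
  have hF : ∀ ξ : ℝ, 𝓕 g ξ = 1 / ((σ : ℂ) + (2 * Real.pi * ξ : ℝ) * Complex.I) ^ 2 := by
    intro ξ
    rw [Real.fourier_real_eq_integral_exp_smul]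
    have hw : 0 < ((σ : ℂ) + (2 * Real.pi * ξ : ℝ) * Complex.I).re := by simpa using hσ
    have := integral_cpow_mul_cexp_neg_mul (s := 2) (by simp) hw
    rw [show Complex.Gamma 2 = 1 by simp] at this
    rw [mul_one, Complex.cpow_neg, Complex.cpow_ofNat] at this
    rw [one_div, ← this, ← setIntegral_eq_integral_of_forall_compl_eq_zero (s := Ioi (0 : ℝ))]
    · refine setIntegral_congr_fun measurableSet_Ioi fun x hx => ?_
      simp only [smul_eq_mul]
      rw [hgpos x hx, mul_left_comm, ← Complex.exp_add]
      congr 2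
      push_cast
      ring
    · intro x hx
      rw [hg0 x hx, smul_zero]
  have hFi : Integrable (𝓕 g) := by
    have h1 := (integrable_norm_rpow_add_mul_I hσ (r := 2) (by norm_num)).comp_mul_left'
      (R := 2 * Real.pi) (by positivity)
    refine h1.mono' ?_ (Eventually.of_forall fun ξ => ?_)
    · have : 𝓕 g = fun ξ : ℝ => 1 / ((σ : ℂ) + (2 * Real.pi * ξ : ℝ) * Complex.I) ^ 2 :=
        funext hF
      rw [this]
      refine Continuous.aestronglyMeasurable (Continuous.div (by fun_prop) (by fun_prop) fun ξ => ?_)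
      exact pow_ne_zero _ (add_mul_I_ne_zero hσ _)
    · rw [hF, norm_div, norm_one, norm_pow, Real.rpow_neg (norm_nonneg _), one_div]
      norm_cast
  have hinv := congrFun (hgc.fourierInv_fourier_eq hgi hFi) y
  rw [Real.fourierInv_eq'] at hinv
  simp_rw [hF] at hinv
  have hsub := Measure.integral_comp_mul_left (fun u : ℝ =>
    Complex.exp ((σ + u * Complex.I) * y) / (σ + u * Complex.I) ^ 2) (2 * Real.pi)
  have hy : ((max y 0 : ℝ) : ℂ) = Complex.exp (σ * y) * g y := by
    simp only [hg]
    push_cast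
    rw [mul_left_comm, ← Complex.exp_add]
    simp
  rw [hy, ← hinv, ← integral_const_mul]
  have hpi : |(2 * Real.pi)⁻¹| = (2 * Real.pi)⁻¹ := abs_of_pos (by positivity)
  rw [hpi, Complex.real_smul] at hsub
  push_cast at hsub
  have h2pi : (2 * (Real.pi : ℂ)) ≠ 0 := by
    exact_mod_cast (by positivity : (2 * Real.pi : ℝ) ≠ 0)
  rw [inv_mul_eq_div, eq_div_iff h2pi] at hsub
  rw [← hsub, mul_comm]
  congr 1
  refine integral_congr_ae (Eventually.of_forall fun ξ => ?_)
  simp only [smul_eq_mul, RCLike.inner_apply, conj_trivial]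
  rw [← mul_assoc, ← Complex.exp_add, mul_one_div]
  push_cast
  congr 2
  ring

open MeasureTheory in
/-- A Laplace transform determines the first Cesàro mean of its measure: Perron's formula. -/
theorem integral_max_sub_eq {α : Type*} [MeasurableSpace α] (μ : Measure α) [SFinite μ]
    {p : α → ℝ} (hp : Measurable p) {σ : ℝ} (hσ : 0 < σ)
    (hint : Integrable (fun a => Real.exp (-(σ * p a))) μ) (T : ℝ) :
    2 * Real.pi * ((∫ a, max (T - p a) 0 ∂μ : ℝ) : ℂ) =
      ∫ u : ℝ, (∫ a, Complex.exp (-((σ + u * Complex.I) * p a)) ∂μ) *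
        (Complex.exp ((σ + u * Complex.I) * T) / (σ + u * Complex.I) ^ 2) := by
  -- Fubini is available because the double pole supplies |s|⁻² in u, while exp(-σp) is integrable
  -- in a.
  have hprod : Integrable (Function.uncurry fun (u : ℝ) (a : α) =>
      Complex.exp (-((σ + u * Complex.I) * p a)) *
        (Complex.exp ((σ + u * Complex.I) * T) / (σ + u * Complex.I) ^ 2))
      ((volume : Measure ℝ).prod μ) := by
    have h1 := ((integrable_norm_rpow_add_mul_I hσ (r := 2) (by norm_num)).mul_const
      (Real.exp (σ * T))).mul_prod hint
    refine h1.mono' ?_ (Eventually.of_forall fun ⟨u, a⟩ => ?_)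
    · refine Measurable.aestronglyMeasurable ?_
      have : Measurable fun z : ℝ × α => p z.2 := hp.comp measurable_snd
      unfold Function.uncurry
      fun_prop
    · simp only [Function.uncurry, norm_mul, norm_div, norm_pow, Complex.norm_exp]
      rw [Real.rpow_neg (norm_nonneg _)]
      simp only [Real.rpow_ofNat, Complex.neg_re, Complex.mul_re, Complex.add_re, Complex.ofReal_re,
        Complex.I_re, mul_zero, Complex.ofReal_im, Complex.I_im, mul_one, sub_self, add_zero,
        sub_zero]
      apply le_of_eq
      ring
  simp_rw [← integral_mul_const]
  rw [integral_integral_swap hprod, ← integral_complex_ofReal, ← integral_const_mul]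
  refine integral_congr_ae (Eventually.of_forall fun a => ?_)
  simp only
  rw [← integral_cexp_div_sq hσ]
  refine integral_congr_ae (Eventually.of_forall fun u => ?_)
  simp only
  rw [← mul_div_assoc, ← Complex.exp_add]
  congr 2
  push_cast
  ring

/-! ### The Gamma kernel: decay and Mellin inversion -/

open MeasureTheory Set in
/-- Exponential decay of `Γ` on vertical lines. -/
lemma norm_Gamma_mul_exp_le {s : ℂ} (hs : 0 < s.re) {θ : ℝ} (h1 : -(Real.pi / 2) < θ)
    (h2 : θ < Real.pi / 2) :
    ‖Complex.Gamma s‖ * Real.exp (θ * s.im) ≤ Real.Gamma s.re * Real.cos θ ^ (-s.re) := by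
  have hcos : 0 < Real.cos θ := Real.cos_pos_of_mem_Ioo ⟨h1, h2⟩
  -- Euler's integral with w = e^{iθ}: the factor w^{-s} has modulus e^{θ Im s}, and the integrand
  -- only sees Re w = cos θ.
  set w : ℂ := Complex.exp (θ * Complex.I) with hw
  have hwre : w.re = Real.cos θ := Complex.exp_ofReal_mul_I_re θ
  have hlog : Complex.log w = θ * Complex.I := by
    apply Complex.log_exp <;> simp <;> linarith [Real.pi_pos]
  have hw0 : w ≠ 0 := Complex.exp_ne_zero _
  have hnorm : ‖w ^ (-s)‖ = Real.exp (θ * s.im) := by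
    rw [Complex.cpow_def_of_ne_zero hw0, hlog, Complex.norm_exp]
    simp
  have h := integral_cpow_mul_cexp_neg_mul hs (w := w) (by rwa [hwre])
  rw [mul_comm, ← hnorm, ← norm_mul, ← h]
  refine (norm_integral_le_integral_norm _).trans (le_of_eq ?_)
  have h3 := Real.integral_rpow_mul_exp_neg_mul_Ioi hs hcos
  rw [one_div, Real.inv_rpow hcos.le, ← Real.rpow_neg hcos.le] at h3
  rw [mul_comm, ← h3]
  refine setIntegral_congr_fun measurableSet_Ioi fun x hx => ?_
  simp only [norm_mul]
  rw [Complex.norm_cpow_eq_rpow_re_of_pos hx, Complex.norm_exp]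
  simp [hwre]

lemma norm_Gamma_le {s : ℂ} (hs : 0 < s.re) : ‖Complex.Gamma s‖ ≤ Real.Gamma s.re := by
  have := norm_Gamma_mul_exp_le hs (θ := 0) (by linarith [Real.pi_pos]) (by linarith [Real.pi_pos])
  simpa using this

/-- The kernel `Γ(s) (2π e^{i(π/2 - δ)})⁻ˢ`. -/
noncomputable def gammaKernel (δ s : ℂ) : ℂ :=
  Complex.Gamma s * Complex.exp (-s * (Real.log (2 * Real.pi) + (Real.pi / 2 - δ) * Complex.I))

/-- The last factor almost cancels the decay of Γ for Im s > 0, leaving a decay rate governed by Re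
δ; for Im s < 0 it decays as well. -/
lemma norm_gammaKernel (δ s : ℂ) :
    ‖gammaKernel δ s‖ = ‖Complex.Gamma s‖ * Real.exp (-s.re * (Real.log (2 * Real.pi) + δ.im)) *
      Real.exp ((Real.pi / 2 - δ.re) * s.im) := by
  rw [gammaKernel, norm_mul, Complex.norm_exp, mul_assoc, ← Real.exp_add]
  congr 2
  simp only [Complex.mul_re, Complex.mul_im, Complex.add_re, Complex.add_im, Complex.neg_re,
    Complex.neg_im, Complex.sub_re, Complex.sub_im, Complex.ofReal_re, Complex.ofReal_im,
    Complex.I_re, Complex.I_im, Complex.div_ofNat_re, Complex.div_ofNat_im]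
  ring

lemma differentiableAt_gammaKernel (δ : ℂ) {s : ℂ} (hs : 0 < s.re) :
    DifferentiableAt ℂ (gammaKernel δ) s := by
  unfold gammaKernel
  refine DifferentiableAt.mul (Complex.differentiableAt_Gamma s fun m h => ?_) (by fun_prop)
  rw [h] at hs
  simp at hs
  linarith [(Nat.cast_nonneg m : (0 : ℝ) ≤ m)]

lemma continuous_gammaKernel_vertical (δ : ℂ) {σ : ℝ} (hσ : 0 < σ) :
    Continuous fun t : ℝ => gammaKernel δ (σ + t * Complex.I) := by
  refine continuous_iff_continuousAt.mpr fun t => ?_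
  have h := (differentiableAt_gammaKernel δ (s := σ + t * Complex.I) (by simpa using hσ)).continuousAt
  exact ContinuousAt.comp (f := fun t : ℝ => (σ : ℂ) + t * Complex.I) h (by fun_prop)

/-- Decay of the kernel in the upper half of the strip, for fixed `δ`. -/
lemma exists_norm_gammaKernel_le {δ : ℂ} (h0 : 0 < δ.re) (h1 : δ.re < Real.pi) :
    ∃ C : ℝ, 0 ≤ C ∧ ∀ σ ∈ Set.Icc (1 / 2 : ℝ) (3 / 2), ∀ t : ℝ, 0 ≤ t →
      ‖gammaKernel δ (σ + t * Complex.I)‖ ≤ C * Real.exp (-(δ.re / 2) * t) := by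
  -- The angle π/2 - Re δ/2 keeps the cosine positive and leaves half of Re δ as exponential decay.
  have hc : 0 < Real.cos (Real.pi / 2 - δ.re / 2) :=
    Real.cos_pos_of_mem_Ioo ⟨by linarith, by linarith⟩
  obtain ⟨C, hC⟩ := isCompact_Icc.exists_bound_of_continuousOn
    (s := Set.Icc (1 / 2 : ℝ) (3 / 2))
    (f := fun σ : ℝ => Real.Gamma σ * Real.cos (Real.pi / 2 - δ.re / 2) ^ (-σ) *
      Real.exp (-σ * (Real.log (2 * Real.pi) + δ.im))) (by
      refine ContinuousOn.mul (ContinuousOn.mul ?_ ?_) (by fun_prop)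
      · intro σ hσ
        refine (Real.differentiableAt_Gamma fun m => ?_).continuousAt.continuousWithinAt
        have : (0 : ℝ) ≤ m := m.cast_nonneg
        linarith [hσ.1]
      · exact ContinuousOn.rpow (by fun_prop) (by fun_prop) fun _ _ => Or.inl hc.ne')
  have hC0 : 0 ≤ C := (norm_nonneg _).trans (hC 1 ⟨by norm_num, by norm_num⟩)
  refine ⟨C, hC0, fun σ hσ t ht => ?_⟩
  have hσ0 : 0 < σ := by linarith [hσ.1]
  have hre : ((σ : ℂ) + t * Complex.I).re = σ := by simp
  have him : ((σ : ℂ) + t * Complex.I).im = t := by simp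
  have hG := norm_Gamma_mul_exp_le (s := σ + t * Complex.I) (by rwa [hre])
    (θ := Real.pi / 2 - δ.re / 2) (by linarith) (by linarith)
  rw [norm_gammaKernel, hre, him]
  rw [hre, him] at hG
  have hexp : Real.exp ((Real.pi / 2 - δ.re) * t) =
      Real.exp ((Real.pi / 2 - δ.re / 2) * t) * Real.exp (-(δ.re / 2) * t) := by
    rw [← Real.exp_add]
    ring_nf
  rw [hexp, ← mul_assoc]
  gcongr
  refine le_trans (le_of_eq ?_) ((mul_le_mul_of_nonneg_right hG
    (Real.exp_nonneg (-σ * (Real.log (2 * Real.pi) + δ.im)))).trans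
    ((le_abs_self _).trans (hC σ hσ)))
  ring

/-- Decay of the kernel on the line `Re s = 3/2` away from the upper half-plane, uniformly for
small `δ`. -/
lemma norm_gammaKernel_three_halves_le {δ : ℂ} (hδ : ‖δ‖ ≤ 1 / 2) {t : ℝ} (ht : t ≤ 1) :
    ‖gammaKernel δ ((3 / 2 : ℝ) + t * Complex.I)‖ ≤
      Real.Gamma (3 / 2) * Real.exp (3 / 4) * Real.exp (t + 3 / 2) := by
  have hre : (((3 / 2 : ℝ) : ℂ) + t * Complex.I).re = 3 / 2 := by simp
  have him : (((3 / 2 : ℝ) : ℂ) + t * Complex.I).im = t := by simp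
  have hG := norm_Gamma_le (s := (3 / 2 : ℝ) + t * Complex.I) (by rw [hre]; norm_num)
  rw [norm_gammaKernel, hre, him]
  rw [hre] at hG
  have hb := abs_le.mp ((Complex.abs_im_le_norm δ).trans hδ)
  have ha := abs_le.mp ((Complex.abs_re_le_norm δ).trans hδ)
  have hlog : 0 ≤ Real.log (2 * Real.pi) := Real.log_nonneg (by linarith [Real.pi_gt_three])
  have hp1 := Real.pi_gt_three
  have hp2 := Real.pi_lt_four
  have hGn : 0 < Real.Gamma (3 / 2) := Real.Gamma_pos_of_pos (by norm_num)
  -- The slope is at least 1, which suffices for t ≤ 0; it is at most 5/2, and for 0 ≤ t ≤ 1 the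
  -- excess is absorbed by 3/2.
  have hexp : (Real.pi / 2 - δ.re) * t ≤ t + 3 / 2 := by
    rcases le_total t 0 with h | h <;> nlinarith
  gcongr
  linarith

open MeasureTheory in
lemma integrable_gammaKernel {δ : ℂ} (hδ : ‖δ‖ ≤ 1 / 2) (h0 : 0 < δ.re) :
    Integrable fun t : ℝ => gammaKernel δ ((3 / 2 : ℝ) + t * Complex.I) := by
  have hcont := continuous_gammaKernel_vertical δ (σ := 3 / 2) (by norm_num)
  have ha := abs_le.mp ((Complex.abs_re_le_norm δ).trans hδ)
  obtain ⟨C, -, hC⟩ := exists_norm_gammaKernel_le h0 (by linarith [Real.pi_gt_three])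
  rw [← integrableOn_univ, ← Set.Iic_union_Ioi (a := (0 : ℝ))]
  refine IntegrableOn.union ?_ ?_
  · have h : IntegrableOn (fun t : ℝ => Real.Gamma (3 / 2) * Real.exp (3 / 4) *
        Real.exp (t + 3 / 2)) (Set.Iic 0) := by
      simp_rw [Real.exp_add]
      exact ((integrableOn_exp_Iic 0).mul_const _).const_mul _
    refine h.mono' hcont.aestronglyMeasurable ?_
    exact (ae_restrict_iff' measurableSet_Iic).mpr (Eventually.of_forall fun t ht =>
      norm_gammaKernel_three_halves_le hδ (le_trans ht zero_le_one))
  · have h : IntegrableOn (fun t : ℝ => C * Real.exp (-(δ.re / 2) * t)) (Set.Ioi 0) :=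
      (integrableOn_exp_mul_Ioi (by linarith) 0).const_mul _
    refine h.mono' hcont.aestronglyMeasurable ?_
    exact (ae_restrict_iff' measurableSet_Ioi).mpr (Eventually.of_forall fun t ht =>
      hC (3 / 2) ⟨by norm_num, le_rfl⟩ t (le_of_lt ht))

/-- Mellin inversion for the exponential function, on the line `Re s = 3/2`. -/
lemma integral_gammaKernel_mul_cpow {δ : ℂ} (hδ : ‖δ‖ ≤ 1 / 2) (h0 : 0 < δ.re) {x : ℝ}
    (hx : 0 < x) :
    ∫ t : ℝ, gammaKernel δ ((3 / 2 : ℝ) + t * Complex.I) *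
        (x : ℂ) ^ (-((3 / 2 : ℝ) + t * Complex.I : ℂ)) =
      2 * Real.pi * Complex.exp (-(2 * Real.pi * x * Complex.I * Complex.exp (-(δ * Complex.I)))) := by
  -- The kernel is the Mellin transform of y ↦ e^{-wy}. The bounds on Re δ keep π/2 - Re δ inside
  -- (-π/2, π/2), so Re w > 0 and the principal logarithm is the expected one.
  set w : ℂ := Complex.exp (Real.log (2 * Real.pi) + (Real.pi / 2 - δ) * Complex.I) with hw
  have h2pi : (0 : ℝ) < 2 * Real.pi := by positivity
  have ha := abs_le.mp ((Complex.abs_re_le_norm δ).trans hδ)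
  have hweq : w = 2 * Real.pi * Complex.I * Complex.exp (-(δ * Complex.I)) := by
    rw [hw, Complex.exp_add, ← Complex.ofReal_exp, Real.exp_log h2pi, sub_mul, sub_eq_add_neg,
      Complex.exp_add, Complex.exp_pi_div_two_mul_I]
    push_cast
    ring
  have hlog : Complex.log w = Real.log (2 * Real.pi) + (Real.pi / 2 - δ) * Complex.I := by
    apply Complex.log_exp
    · simp; linarith [Real.pi_gt_three]
    · simp; linarith [Real.pi_gt_three]
  have hw0 : w ≠ 0 := Complex.exp_ne_zero _
  have hwre : 0 < w.re := by
    rw [hw, Complex.exp_re]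
    refine mul_pos (Real.exp_pos _) (Real.cos_pos_of_mem_Ioo ⟨?_, ?_⟩)
    · simp; linarith [Real.pi_gt_three]
    · simp; linarith
  have hmellin : ∀ s : ℂ, 0 < s.re →
      mellin (fun y : ℝ => Complex.exp (-(w * y))) s = gammaKernel δ s := by
    intro s hs
    simp only [mellin, smul_eq_mul]
    rw [integral_cpow_mul_cexp_neg_mul hs hwre, Complex.cpow_def_of_ne_zero hw0, hlog, gammaKernel,
      mul_comm]
    ring_nf
  have hline : ∀ t : ℝ, mellin (fun y : ℝ => Complex.exp (-(w * y))) ((3 / 2 : ℝ) + t * Complex.I) =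
      gammaKernel δ ((3 / 2 : ℝ) + t * Complex.I) := fun t => hmellin _ (by simp)
  have hinv := mellinInv_mellin_eq (3 / 2) (fun y : ℝ => Complex.exp (-(w * y))) hx ?_ ?_ ?_
  · rw [mellinInv] at hinv
    simp_rw [hline, smul_eq_mul] at hinv
    have h2pi' : (2 * (Real.pi : ℂ)) ≠ 0 := by exact_mod_cast h2pi.ne'
    rw [Complex.real_smul] at hinv
    push_cast at hinv
    rw [one_div, inv_mul_eq_div, div_eq_iff h2pi'] at hinv
    push_cast
    rw [show 2 * (Real.pi : ℂ) * x * Complex.I * Complex.exp (-(δ * Complex.I)) = w * x by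
      rw [hweq]; ring, mul_comm (2 * (Real.pi : ℂ)), ← hinv]
    refine MeasureTheory.integral_congr_ae (Eventually.of_forall fun t => ?_)
    simp only
    rw [mul_comm]
  · exact integrableOn_cpow_mul_cexp_neg_mul (by simp) hwre
  · refine (integrable_gammaKernel hδ h0).congr (Eventually.of_forall fun t => ?_)
    exact (hline t).symm
  · fun_prop

/-! ### Expansion of ζ² on the line Re s = 3/2 -/

/-- The product `(m + 1)(k + 1)` attached to a pair `(m, k)`. -/
def shiftedProd (q : ℕ × ℕ) : ℝ := ((q.1 : ℝ) + 1) * ((q.2 : ℝ) + 1)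

lemma one_le_shiftedProd (q : ℕ × ℕ) : 1 ≤ shiftedProd q := by
  have h1 : (0 : ℝ) ≤ q.1 := q.1.cast_nonneg
  have h2 : (0 : ℝ) ≤ q.2 := q.2.cast_nonneg
  unfold shiftedProd
  nlinarith

lemma shiftedProd_pos (q : ℕ × ℕ) : 0 < shiftedProd q := zero_lt_one.trans_le (one_le_shiftedProd q)

lemma summable_shiftedProd_rpow {a : ℝ} (ha : 1 < a) :
    Summable fun q : ℕ × ℕ => shiftedProd q ^ (-a) := by
  have h := summable_nat_add_one_rpow ha
  refine (h.mul_of_nonneg h (fun n => by positivity) fun n => by positivity).congr fun q => ?_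
  rw [shiftedProd, Real.mul_rpow (by positivity) (by positivity)]

/-- Keeping pairs instead of collecting them into the divisor function makes this a product of two
absolutely convergent series. -/
lemma hasSum_riemannZeta_sq {s : ℂ} (hs : 1 < s.re) :
    HasSum (fun q : ℕ × ℕ => (shiftedProd q : ℂ) ^ (-s)) (riemannZeta s ^ 2) := by
  have hnorm : ∀ n : ℕ, ‖1 / ((n : ℂ) + 1) ^ s‖ = ((n : ℝ) + 1) ^ (-s.re) := by
    intro n
    have := Complex.norm_cpow_eq_rpow_re_of_pos (x := (n : ℝ) + 1) (by positivity) s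
    push_cast at this
    rw [norm_div, this, norm_one, Real.rpow_neg (by positivity), one_div]
  have hsum : Summable fun n : ℕ => ‖1 / ((n : ℂ) + 1) ^ s‖ := by
    simp_rw [hnorm]
    exact summable_nat_add_one_rpow hs
  have hz : HasSum (fun n : ℕ => 1 / ((n : ℂ) + 1) ^ s) (riemannZeta s) := by
    rw [zeta_eq_tsum_one_div_nat_add_one_cpow hs]
    exact hsum.of_norm.hasSum
  have heq : (fun q : ℕ × ℕ => (shiftedProd q : ℂ) ^ (-s)) =
      fun q : ℕ × ℕ => 1 / ((q.1 : ℂ) + 1) ^ s * (1 / ((q.2 : ℂ) + 1) ^ s) := by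
    funext q
    have h1 : (0 : ℝ) ≤ (q.1 : ℝ) + 1 := by positivity
    have h2 : (0 : ℝ) ≤ (q.2 : ℝ) + 1 := by positivity
    rw [shiftedProd, Complex.cpow_neg, Complex.ofReal_mul, Complex.mul_cpow_ofReal_nonneg h1 h2]
    push_cast
    rw [mul_inv, one_div, one_div]
  rw [heq, sq]
  rw [← hz.tsum_eq, tsum_mul_tsum_of_summable_norm hsum hsum]
  exact (summable_mul_of_summable_norm hsum hsum).hasSum

open MeasureTheory in
/-- The full line integral of `ζ(s)²` against the kernel is a Lambert-type series. -/
theorem integral_gammaKernel_mul_riemannZeta_sq {δ : ℂ} (hδ : ‖δ‖ ≤ 1 / 2) (h0 : 0 < δ.re) :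
    ∫ t : ℝ, gammaKernel δ ((3 / 2 : ℝ) + t * Complex.I) *
        riemannZeta ((3 / 2 : ℝ) + t * Complex.I) ^ 2 =
      2 * Real.pi * ∑' q : ℕ × ℕ, Complex.exp
        (-(2 * Real.pi * shiftedProd q * Complex.I * Complex.exp (-(δ * Complex.I)))) := by
  have hK := integrable_gammaKernel hδ h0
  have hnorm : ∀ (q : ℕ × ℕ) (t : ℝ), ‖(shiftedProd q : ℂ) ^ (-((3 / 2 : ℝ) + t * Complex.I : ℂ))‖ =
      shiftedProd q ^ (-(3 / 2) : ℝ) := by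
    intro q t
    rw [Complex.norm_cpow_eq_rpow_re_of_pos (shiftedProd_pos q)]
    simp
  have hcpow : ∀ q : ℕ × ℕ, Continuous fun t : ℝ =>
      (shiftedProd q : ℂ) ^ (-((3 / 2 : ℝ) + t * Complex.I : ℂ)) := by
    intro q
    refine Continuous.const_cpow (by fun_prop) (Or.inl ?_)
    exact_mod_cast (shiftedProd_pos q).ne'
  have hint : ∀ q : ℕ × ℕ, Integrable fun t : ℝ => gammaKernel δ ((3 / 2 : ℝ) + t * Complex.I) *
      (shiftedProd q : ℂ) ^ (-((3 / 2 : ℝ) + t * Complex.I : ℂ)) := by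
    intro q
    refine hK.mul_bdd (c := shiftedProd q ^ (-(3 / 2) : ℝ)) (hcpow q).aestronglyMeasurable
      (Eventually.of_forall fun t => (hnorm q t).le)
  -- Sum and integral commute because each term has size (product)^{-3/2} times the integrable
  -- kernel.
  have key := hasSum_integral_of_summable_integral_norm hint ?_
  · rw [← tsum_mul_left]
    simp_rw [integral_gammaKernel_mul_cpow hδ h0 (shiftedProd_pos _)] at key
    rw [key.tsum_eq]
    refine integral_congr_ae (Eventually.of_forall fun t => ?_)
    simp only
    rw [tsum_mul_left, (hasSum_riemannZeta_sq (by norm_num)).tsum_eq]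
  · simp_rw [norm_mul, hnorm, integral_mul_const]
    exact (summable_shiftedProd_rpow (by norm_num)).mul_left _

/-! ### The critical line and the contour shift -/

/-- On the critical line the conjugate of s is 1 - s, so |ζ(s)|² = ζ(s) ζ(1 - s), and the functional
equation gives 2 (2π)^{-s} Γ(s) cos(πs/2) ζ(s)². The correction factor is 2 cos(πs/2) e^{iπs/2} = 1
+ e^{iπs}. -/
lemma gammaKernel_mul_riemannZeta_sq_critical (δ : ℂ) (t : ℝ) :
    gammaKernel δ ((1 / 2 : ℝ) + t * Complex.I) * riemannZeta ((1 / 2 : ℝ) + t * Complex.I) ^ 2 *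
        (1 + Complex.I * Real.exp (-(Real.pi * t))) =
      (‖riemannZeta (1 / 2 + t * Complex.I)‖ ^ 2 : ℝ) *
        (Complex.exp (δ / 2 * Complex.I) * Complex.exp (-(δ * t))) := by
  have hs2 : (((1 / 2 : ℝ) : ℂ) + t * Complex.I) = 1 / 2 + t * Complex.I := by push_cast; ring
  rw [hs2]
  set s : ℂ := 1 / 2 + t * Complex.I with hs
  have hre : s.re = 1 / 2 := by simp [hs]
  have hconj : (starRingEnd ℂ) s = 1 - s := by
    apply Complex.ext <;> simp [hs]; norm_num
  have hfe := riemannZeta_one_sub (s := s) (fun n h => by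
    have := congrArg Complex.re h
    rw [hre] at this
    simp at this
    linarith [(Nat.cast_nonneg n : (0 : ℝ) ≤ n)]) (fun h => by
    have := congrArg Complex.re h
    rw [hre] at this
    norm_num at this)
  have hsq : ((‖riemannZeta s‖ ^ 2 : ℝ) : ℂ) = riemannZeta s * riemannZeta (1 - s) := by
    rw [← hconj, riemannZeta_conj, Complex.mul_conj, Complex.normSq_eq_norm_sq]
  have hlog : (2 * (Real.pi : ℂ)) ^ (-s) = Complex.exp (-s * Real.log (2 * Real.pi)) := by
    have h0 : (2 * (Real.pi : ℂ)) = ((2 * Real.pi : ℝ) : ℂ) := by push_cast; rfl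
    rw [h0, Complex.cpow_def_of_ne_zero (by exact_mod_cast (by positivity : (2 * Real.pi) ≠ 0)),
      Complex.ofReal_log (by positivity), mul_comm]
  have hE : Complex.exp (-s * (Real.log (2 * Real.pi) + (Real.pi / 2 - δ) * Complex.I)) =
      Complex.exp (-s * Real.log (2 * Real.pi)) * Complex.exp (-(Real.pi * s / 2) * Complex.I) *
        (Complex.exp (δ / 2 * Complex.I) * Complex.exp (-(δ * t))) := by
    rw [← Complex.exp_add, ← Complex.exp_add, ← Complex.exp_add]
    congr 1
    rw [hs]
    linear_combination (δ * t) * Complex.I_sq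
  have hI : 1 + Complex.I * (Real.exp (-(Real.pi * t)) : ℂ) =
      2 * Complex.cos (Real.pi * s / 2) * Complex.exp (Real.pi * s / 2 * Complex.I) := by
    rw [Complex.two_cos, add_mul, ← Complex.exp_add, ← Complex.exp_add, add_comm]
    congr 1
    · rw [show Real.pi * s / 2 * Complex.I + Real.pi * s / 2 * Complex.I =
        Real.pi / 2 * Complex.I + ((-(Real.pi * t) : ℝ) : ℂ) by
        rw [hs]; push_cast; linear_combination (Real.pi * t : ℂ) * Complex.I_sq,
        Complex.exp_add, Complex.exp_pi_div_two_mul_I, Complex.ofReal_exp]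
    · rw [← Complex.exp_zero]
      congr 1
      ring
  have hcancel : Complex.exp (-(Real.pi * s / 2) * Complex.I) *
      Complex.exp (Real.pi * s / 2 * Complex.I) = 1 := by
    rw [← Complex.exp_add, ← Complex.exp_zero]
    congr 1
    ring
  rw [hsq, hfe, hlog, hI, gammaKernel, hE]
  linear_combination (Complex.Gamma s * Complex.exp (-s * Real.log (2 * Real.pi)) *
    (Complex.exp (δ / 2 * Complex.I) * Complex.exp (-(δ * t))) * riemannZeta s ^ 2 *
    2 * Complex.cos (Real.pi * s / 2)) * hcancel

lemma continuous_riemannZeta_vertical {σ : ℝ} (hσ : σ ≠ 1) :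
    Continuous fun t : ℝ => riemannZeta (σ + t * Complex.I) := by
  refine continuous_iff_continuousAt.mpr fun t => ?_
  have h := (differentiableAt_riemannZeta (s := σ + t * Complex.I) (fun h => hσ (by
    simpa using congrArg Complex.re h))).continuousAt
  exact ContinuousAt.comp (f := fun t : ℝ => (σ : ℂ) + t * Complex.I) h (by fun_prop)

lemma continuous_riemannZeta_critical :
    Continuous fun t : ℝ => riemannZeta (1 / 2 + t * Complex.I) := by
  have := continuous_riemannZeta_vertical (σ := 1 / 2) (by norm_num)
  push_cast at this
  exact this

/-- Polynomial growth of `ζ²` in the strip `1/2 ≤ Re s ≤ 3/2`. -/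
lemma exists_norm_riemannZeta_sq_le :
    ∃ C : ℝ, 0 ≤ C ∧ ∀ σ ∈ Set.Icc (1 / 2 : ℝ) (3 / 2), ∀ t : ℝ, 1 ≤ t →
      ‖riemannZeta (σ + t * Complex.I)‖ ^ 2 ≤ C * t ^ 2 := by
  obtain ⟨C, hC0, hC⟩ := exists_norm_riemannZeta_le
  refine ⟨(C * (5 / 2)) ^ 2, by positivity, fun σ hσ t ht => ?_⟩
  have h := hC (σ + t * Complex.I) (by simpa using hσ.1) (by simpa using ht)
  have hn : ‖(σ : ℂ) + t * Complex.I‖ ≤ 5 / 2 * t := by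
    refine (norm_add_le _ _).trans ?_
    have h1 : |σ| = σ := abs_of_nonneg (by linarith [hσ.1])
    have h2 : |t| = t := abs_of_nonneg (by linarith)
    simp only [Complex.norm_real, norm_mul, Complex.norm_I, mul_one, Real.norm_eq_abs, h1, h2]
    linarith [hσ.2]
  rw [← mul_pow, mul_assoc]
  exact pow_le_pow_left₀ (norm_nonneg _) (h.trans (by gcongr)) 2

lemma integrableOn_sq_mul_exp {b : ℝ} (hb : 0 < b) (c : ℝ) (hc : 0 ≤ c) :
    MeasureTheory.IntegrableOn (fun t : ℝ => t ^ 2 * Real.exp (-b * t)) (Set.Ioi c) := by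
  have := integrableOn_rpow_mul_exp_neg_mul_rpow (p := 1) (s := 2) (b := b) (by norm_num) one_pos hb
  simp only [Real.rpow_one, Real.rpow_ofNat] at this
  exact this.mono_set (Set.Ioi_subset_Ioi hc)

open MeasureTheory in
lemma integrableOn_riemannZeta_sq_mul_exp {a : ℝ} (ha : 0 < a) :
    IntegrableOn (fun t : ℝ => ‖riemannZeta (1 / 2 + t * Complex.I)‖ ^ 2 * Real.exp (-(a * t)))
      (Set.Ioi 1) := by
  obtain ⟨C, -, hC⟩ := exists_norm_riemannZeta_sq_le
  refine ((integrableOn_sq_mul_exp ha 1 zero_le_one).const_mul C).mono' ?_ ?_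
  · have := continuous_riemannZeta_critical
    exact (by fun_prop : Continuous _).aestronglyMeasurable
  · refine (ae_restrict_iff' measurableSet_Ioi).mpr (Eventually.of_forall fun t ht => ?_)
    have := hC (1 / 2) ⟨le_rfl, by norm_num⟩ t (le_of_lt ht)
    push_cast at this
    rw [Real.norm_of_nonneg (by positivity), ← mul_assoc, neg_mul]
    gcongr

open MeasureTheory in
lemma integrableOn_riemannZeta_sq_mul_cexp {δ : ℂ} (h0 : 0 < δ.re) :
    IntegrableOn (fun t : ℝ => ((‖riemannZeta (1 / 2 + t * Complex.I)‖ ^ 2 : ℝ) : ℂ) *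
      Complex.exp (-(δ * t))) (Set.Ioi 1) := by
  refine (integrableOn_riemannZeta_sq_mul_exp h0).mono' ?_ (Eventually.of_forall fun t => ?_)
  · have := continuous_riemannZeta_critical
    exact (by fun_prop : Continuous _).aestronglyMeasurable
  · rw [norm_mul, Complex.norm_real, Complex.norm_exp, Real.norm_of_nonneg (by positivity)]
    simp

lemma re_im_bounds {δ : ℂ} (hδ : ‖δ‖ ≤ 1 / 2) :
    (-(1 / 2) ≤ δ.re ∧ δ.re ≤ 1 / 2) ∧ (-(1 / 2) ≤ δ.im ∧ δ.im ≤ 1 / 2) :=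
  ⟨abs_le.mp ((Complex.abs_re_le_norm δ).trans hδ), abs_le.mp ((Complex.abs_im_le_norm δ).trans hδ)⟩

open MeasureTheory in
lemma integrableOn_gammaKernel_mul_riemannZeta_sq {δ : ℂ} (hδ : ‖δ‖ ≤ 1 / 2) (h0 : 0 < δ.re)
    {σ : ℝ} (hσ : σ ∈ Set.Icc (1 / 2 : ℝ) (3 / 2)) (hσ1 : σ ≠ 1) :
    IntegrableOn (fun t : ℝ => gammaKernel δ (σ + t * Complex.I) *
      riemannZeta (σ + t * Complex.I) ^ 2) (Set.Ioi 1) := by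
  obtain ⟨C, -, hC⟩ := exists_norm_riemannZeta_sq_le
  obtain ⟨D, hD0, hD⟩ := exists_norm_gammaKernel_le h0
    (by linarith [Real.pi_gt_three, (re_im_bounds hδ).1.2])
  refine ((integrableOn_sq_mul_exp (half_pos h0) 1 zero_le_one).const_mul (D * C)).mono' ?_ ?_
  · exact ((continuous_gammaKernel_vertical δ (by linarith [hσ.1])).mul
      ((continuous_riemannZeta_vertical hσ1).pow 2)).aestronglyMeasurable
  · refine (ae_restrict_iff' measurableSet_Ioi).mpr (Eventually.of_forall fun t ht => ?_)
    have ht1 : (1 : ℝ) ≤ t := le_of_lt ht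
    rw [norm_mul, norm_pow]
    calc _ ≤ (D * Real.exp (-(δ.re / 2) * t)) * (C * t ^ 2) := by
          gcongr
          · exact hD σ hσ t (by linarith)
          · exact hC σ hσ t ht1
      _ = _ := by ring

open MeasureTheory in
/-- On the critical line the kernel turns `ζ²` into `|ζ|²`, up to a bounded error. -/
lemma exists_critical_line_bound :
    ∃ C : ℝ, ∀ δ : ℂ, ‖δ‖ ≤ 1 / 2 → 0 < δ.re →
      ‖(∫ t in Set.Ioi (1 : ℝ), gammaKernel δ ((1 / 2 : ℝ) + t * Complex.I) *
          riemannZeta ((1 / 2 : ℝ) + t * Complex.I) ^ 2) -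
        Complex.exp (δ / 2 * Complex.I) *
          ∫ t in Set.Ioi (1 : ℝ), ((‖riemannZeta (1 / 2 + t * Complex.I)‖ ^ 2 : ℝ) : ℂ) *
            Complex.exp (-(δ * t))‖ ≤ C := by
  refine ⟨∫ t in Set.Ioi (1 : ℝ), Real.exp (1 / 4) *
    (‖riemannZeta (1 / 2 + t * Complex.I)‖ ^ 2 * Real.exp (-(Real.pi * t))), fun δ hδ h0 => ?_⟩
  rw [← integral_const_mul, ← integral_sub
    (integrableOn_gammaKernel_mul_riemannZeta_sq hδ h0 ⟨le_rfl, by norm_num⟩ (by norm_num))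
    ((integrableOn_riemannZeta_sq_mul_cexp h0).const_mul _)]
  refine norm_integral_le_of_norm_le
    ((integrableOn_riemannZeta_sq_mul_exp Real.pi_pos).const_mul _)
    ((ae_restrict_iff' measurableSet_Ioi).mpr (Eventually.of_forall fun t ht => ?_))
  have ht1 : (1 : ℝ) < t := ht
  have key := gammaKernel_mul_riemannZeta_sq_critical δ t
  set e : ℝ := Real.exp (-(Real.pi * t))
  set F : ℂ := gammaKernel δ ((1 / 2 : ℝ) + t * Complex.I) *
    riemannZeta ((1 / 2 : ℝ) + t * Complex.I) ^ 2
  set G : ℂ := ((‖riemannZeta (1 / 2 + t * Complex.I)‖ ^ 2 : ℝ) : ℂ) *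
    (Complex.exp (δ / 2 * Complex.I) * Complex.exp (-(δ * t))) with hG
  have he : 0 < e := Real.exp_pos _
  -- The real part is 1, so dividing by this factor never enlarges anything.
  have hone : 1 ≤ ‖1 + Complex.I * (e : ℂ)‖ := by
    have := Complex.re_le_norm (1 + Complex.I * (e : ℂ))
    simpa using this
  have hFG : ‖F‖ ≤ ‖G‖ := by
    rw [← key, norm_mul F]
    exact le_mul_of_one_le_right (norm_nonneg F) hone
  have hGn : ‖G‖ ≤ Real.exp (1 / 4) * ‖riemannZeta (1 / 2 + t * Complex.I)‖ ^ 2 := by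
    rw [hG, norm_mul, Complex.norm_real, Real.norm_of_nonneg (by positivity), ← Complex.exp_add,
      Complex.norm_exp, mul_comm]
    gcongr
    have h3 := (re_im_bounds hδ).2.1
    simp only [Complex.add_re, Complex.mul_re, Complex.I_re, Complex.I_im, mul_zero, mul_one,
      Complex.neg_re, Complex.ofReal_re, Complex.ofReal_im, Complex.div_ofNat_im]
    nlinarith
  -- The discrepancy carries e^{-πt}, which beats the growth of |ζ|² uniformly in δ.
  have hdiff : F - Complex.exp (δ / 2 * Complex.I) *
      (((‖riemannZeta (1 / 2 + t * Complex.I)‖ ^ 2 : ℝ) : ℂ) * Complex.exp (-(δ * t))) =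
      -(Complex.I * e * F) := by
    have : G = Complex.exp (δ / 2 * Complex.I) *
      (((‖riemannZeta (1 / 2 + t * Complex.I)‖ ^ 2 : ℝ) : ℂ) * Complex.exp (-(δ * t))) := by
      rw [hG]; ring
    rw [← this, ← key]
    ring
  rw [hdiff, norm_neg, norm_mul, norm_mul, Complex.norm_I, one_mul, Complex.norm_real,
    Real.norm_of_nonneg he.le, ← mul_assoc, mul_comm]
  gcongr
  exact hFG.trans hGn

/-- Controls the bottom edge of the shifted contour, the only horizontal edge that survives in the
limit. -/
lemma exists_norm_gammaKernel_bottom_le :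
    ∃ C : ℝ, ∀ δ : ℂ, ‖δ‖ ≤ 1 / 2 → ∀ x ∈ Set.Icc (1 / 2 : ℝ) (3 / 2),
      ‖gammaKernel δ (x + (1 : ℝ) * Complex.I) * riemannZeta (x + (1 : ℝ) * Complex.I) ^ 2‖ ≤ C := by
  obtain ⟨C, hC0, hC⟩ := exists_norm_riemannZeta_sq_le
  obtain ⟨D, hD⟩ := isCompact_Icc.exists_bound_of_continuousOn
    (s := Set.Icc (1 / 2 : ℝ) (3 / 2)) (f := Real.Gamma) (fun σ hσ => by
      refine (Real.differentiableAt_Gamma fun m => ?_).continuousAt.continuousWithinAt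
      have : (0 : ℝ) ≤ m := m.cast_nonneg
      linarith [hσ.1])
  have hD0 : 0 ≤ D := (norm_nonneg _).trans (hD 1 ⟨by norm_num, by norm_num⟩)
  refine ⟨D * Real.exp (3 / 4) * Real.exp 3 * C, fun δ hδ x hx => ?_⟩
  have hre : ((x : ℂ) + (1 : ℝ) * Complex.I).re = x := by simp
  have him : ((x : ℂ) + (1 : ℝ) * Complex.I).im = 1 := by simp
  have hx0 : 0 < x := by linarith [hx.1]
  have hG : ‖Complex.Gamma (x + (1 : ℝ) * Complex.I)‖ ≤ D := by
    refine (norm_Gamma_le (by rwa [hre])).trans ?_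
    rw [hre]
    exact (le_abs_self _).trans (hD x hx)
  have hlog : 0 ≤ Real.log (2 * Real.pi) := Real.log_nonneg (by linarith [Real.pi_gt_three])
  have hp2 := Real.pi_lt_four
  obtain ⟨ha, hb⟩ := re_im_bounds hδ
  have hz := hC x hx 1 le_rfl
  rw [norm_mul, norm_gammaKernel, hre, him, norm_pow]
  rw [one_pow, mul_one] at hz
  gcongr
  · nlinarith [hx.1, hx.2]
  · linarith

open MeasureTheory in
/-- Shifting the contour between the lines `Re s = 1/2` and `Re s = 3/2` above height `1`. -/
lemma exists_contour_shift_bound :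
    ∃ C : ℝ, ∀ δ : ℂ, ‖δ‖ ≤ 1 / 2 → 0 < δ.re →
      ‖(∫ t in Set.Ioi (1 : ℝ), gammaKernel δ ((1 / 2 : ℝ) + t * Complex.I) *
          riemannZeta ((1 / 2 : ℝ) + t * Complex.I) ^ 2) -
        ∫ t in Set.Ioi (1 : ℝ), gammaKernel δ ((3 / 2 : ℝ) + t * Complex.I) *
          riemannZeta ((3 / 2 : ℝ) + t * Complex.I) ^ 2‖ ≤ C := by
  obtain ⟨B, hB⟩ := exists_norm_gammaKernel_bottom_le
  refine ⟨B, fun δ hδ h0 => ?_⟩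
  set F : ℂ → ℂ := fun s => gammaKernel δ s * riemannZeta s ^ 2 with hF
  -- Cauchy's theorem on a rectangle; starting at height 1 keeps the pole of ζ² outside.
  have hrect : ∀ R : ℝ, 1 ≤ R →
      (∫ y in (1 : ℝ)..R, F ((1 / 2 : ℝ) + y * Complex.I)) -
        (∫ y in (1 : ℝ)..R, F ((3 / 2 : ℝ) + y * Complex.I)) =
      -Complex.I * ((∫ x in (1 / 2 : ℝ)..(3 / 2), F (x + (1 : ℝ) * Complex.I)) -
        ∫ x in (1 / 2 : ℝ)..(3 / 2), F (x + R * Complex.I)) := by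
    intro R hR
    have h := Complex.integral_boundary_rect_eq_zero_of_differentiableOn F
      ((1 / 2 : ℝ) + (1 : ℝ) * Complex.I) ((3 / 2 : ℝ) + R * Complex.I) (fun s hs => by
        have h1 := hs.1
        have h2 := hs.2
        simp only [Set.mem_preimage, Complex.add_re, Complex.add_im, Complex.mul_re, Complex.mul_im,
          Complex.ofReal_re, Complex.ofReal_im, Complex.I_re, Complex.I_im, mul_zero, mul_one,
          sub_self, add_zero, zero_add] at h1 h2
        rw [Set.uIcc_of_le (by norm_num)] at h1
        rw [Set.uIcc_of_le hR] at h2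
        refine DifferentiableAt.differentiableWithinAt (DifferentiableAt.mul
          (differentiableAt_gammaKernel δ (by linarith [h1.1]))
          ((differentiableAt_riemannZeta ?_).pow 2))
        rintro rfl
        have := h2.1
        norm_num at this)
    simp only [Complex.add_re, Complex.add_im, Complex.mul_re, Complex.mul_im,
      Complex.ofReal_re, Complex.ofReal_im, Complex.I_re, Complex.I_im, mul_zero, mul_one,
      sub_self, add_zero, zero_add, smul_eq_mul] at h
    linear_combination Complex.I * h - ((∫ y in (1 : ℝ)..R, F ((3 / 2 : ℝ) + y * Complex.I)) -
      ∫ y in (1 : ℝ)..R, F ((1 / 2 : ℝ) + y * Complex.I)) * Complex.I_sq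
  have hl := intervalIntegral_tendsto_integral_Ioi 1
    (integrableOn_gammaKernel_mul_riemannZeta_sq hδ h0 (σ := 1 / 2) ⟨le_rfl, by norm_num⟩
      (by norm_num)) tendsto_id
  have hr := intervalIntegral_tendsto_integral_Ioi 1
    (integrableOn_gammaKernel_mul_riemannZeta_sq hδ h0 (σ := 3 / 2) ⟨by norm_num, le_rfl⟩
      (by norm_num)) tendsto_id
  -- For fixed δ the exponential decay of the kernel beats the R² growth of ζ².
  have htop : Tendsto (fun R : ℝ => ∫ x in (1 / 2 : ℝ)..(3 / 2), F (x + R * Complex.I)) atTop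
      (𝓝 0) := by
    obtain ⟨C, hC0, hC⟩ := exists_norm_riemannZeta_sq_le
    obtain ⟨D, hD0, hD⟩ := exists_norm_gammaKernel_le h0
      (by linarith [Real.pi_gt_three, (re_im_bounds hδ).1.2])
    have hlim : Tendsto (fun R : ℝ => D * C * (R ^ (2 : ℝ) * Real.exp (-(δ.re / 2) * R))) atTop
        (𝓝 0) := by
      simpa using (tendsto_rpow_mul_exp_neg_mul_atTop_nhds_zero 2 _ (half_pos h0)).const_mul (D * C)
    refine squeeze_zero_norm' ?_ hlim
    filter_upwards [eventually_ge_atTop 1] with R hR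
    have := intervalIntegral.norm_integral_le_of_norm_le_const (a := (1 / 2 : ℝ)) (b := 3 / 2)
      (f := fun x : ℝ => F (x + R * Complex.I))
      (C := D * C * (R ^ (2 : ℝ) * Real.exp (-(δ.re / 2) * R))) (fun x hx => by
        rw [Set.uIoc_of_le (by norm_num)] at hx
        have hx' : x ∈ Set.Icc (1 / 2 : ℝ) (3 / 2) := ⟨hx.1.le, hx.2⟩
        rw [hF, norm_mul, norm_pow]
        calc _ ≤ (D * Real.exp (-(δ.re / 2) * R)) * (C * R ^ 2) := by
              gcongr
              · exact hD x hx' R (by linarith)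
              · exact hC x hx' R hR
          _ = _ := by rw [Real.rpow_ofNat]; ring)
    refine this.trans (le_of_eq ?_)
    norm_num
  have hlim := (hl.sub hr)
  have hlim2 := ((htop.const_sub (∫ x in (1 / 2 : ℝ)..(3 / 2), F (x + (1 : ℝ) * Complex.I))).const_mul
    (-Complex.I))
  have heq := tendsto_nhds_unique (hlim.congr' (by
    filter_upwards [eventually_ge_atTop 1] with R hR using hrect R hR)) hlim2
  rw [heq, sub_zero, norm_mul, norm_neg, Complex.norm_I, one_mul]
  have := intervalIntegral.norm_integral_le_of_norm_le_const (a := (1 / 2 : ℝ)) (b := 3 / 2)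
    (f := fun x : ℝ => F (x + (1 : ℝ) * Complex.I)) (C := B) (fun x hx => by
      rw [Set.uIoc_of_le (by norm_num)] at hx
      exact hB δ hδ x ⟨hx.1.le, hx.2⟩)
  refine this.trans (le_of_eq ?_)
  norm_num

lemma norm_riemannZeta_three_halves_le (t : ℝ) :
    ‖riemannZeta ((3 / 2 : ℝ) + t * Complex.I)‖ ^ 2 ≤
      ∑' q : ℕ × ℕ, shiftedProd q ^ (-(3 / 2) : ℝ) := by
  have h := hasSum_riemannZeta_sq (s := (3 / 2 : ℝ) + t * Complex.I) (by norm_num)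
  rw [← norm_pow, ← h.tsum_eq]
  refine tsum_of_norm_bounded (summable_shiftedProd_rpow (by norm_num)).hasSum fun q => ?_
  rw [Complex.norm_cpow_eq_rpow_re_of_pos (shiftedProd_pos q)]
  simp

open MeasureTheory in
lemma integrable_gammaKernel_mul_riemannZeta_sq {δ : ℂ} (hδ : ‖δ‖ ≤ 1 / 2) (h0 : 0 < δ.re) :
    Integrable fun t : ℝ => gammaKernel δ ((3 / 2 : ℝ) + t * Complex.I) *
        riemannZeta ((3 / 2 : ℝ) + t * Complex.I) ^ 2 := by
  refine (integrable_gammaKernel hδ h0).mul_bdd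
    (c := ∑' q : ℕ × ℕ, shiftedProd q ^ (-(3 / 2) : ℝ))
    (((continuous_riemannZeta_vertical (by norm_num)).pow 2).aestronglyMeasurable)
    (Eventually.of_forall fun t => ?_)
  rw [norm_pow]
  exact norm_riemannZeta_three_halves_le t

-- Here the kernel is dominated by a multiple of e^t independently of δ and ζ² is bounded, so
-- completing the line costs O(1).
open MeasureTheory in
lemma exists_lower_half_bound :
    ∃ C : ℝ, ∀ δ : ℂ, ‖δ‖ ≤ 1 / 2 → 0 < δ.re →
      ‖∫ t in Set.Iic (1 : ℝ), gammaKernel δ ((3 / 2 : ℝ) + t * Complex.I) *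
          riemannZeta ((3 / 2 : ℝ) + t * Complex.I) ^ 2‖ ≤ C := by
  set Z : ℝ := ∑' q : ℕ × ℕ, shiftedProd q ^ (-(3 / 2) : ℝ)
  have hint : IntegrableOn (fun t : ℝ => Real.Gamma (3 / 2) * Real.exp (3 / 4) *
        Real.exp (t + 3 / 2) * Z) (Set.Iic 1) := by
    simp_rw [Real.exp_add]
    exact (((integrableOn_exp_Iic 1).mul_const _).const_mul _).mul_const _
  refine ⟨∫ t in Set.Iic (1 : ℝ), Real.Gamma (3 / 2) * Real.exp (3 / 4) *
        Real.exp (t + 3 / 2) * Z, fun δ hδ h0 => ?_⟩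
  refine norm_integral_le_of_norm_le hint
    ((ae_restrict_iff' measurableSet_Iic).mpr (Eventually.of_forall fun t ht => ?_))
  rw [norm_mul, norm_pow]
  have h1 := norm_gammaKernel_three_halves_le hδ ht
  exact mul_le_mul h1 (norm_riemannZeta_three_halves_le t) (by positivity)
    ((norm_nonneg _).trans h1)

/-- The Lambert-type series `∑ exp(-2πi n e^{-iδ})` over pairs `(m, k)` with `n = mk`. -/
noncomputable def rotatedSeries (δ : ℂ) : ℂ :=
  ∑' q : ℕ × ℕ, Complex.exp
    (-(2 * Real.pi * shiftedProd q * Complex.I * Complex.exp (-(δ * Complex.I))))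

open MeasureTheory in
/-- The Laplace transform of `|ζ(1/2 + it)|²` is a Lambert-type series, up to a bounded error. -/
theorem exists_laplace_sub_rotatedSeries_bound :
    ∃ C : ℝ, ∀ δ : ℂ, ‖δ‖ ≤ 1 / 2 → 0 < δ.re →
      ‖(∫ t in Set.Ioi (1 : ℝ), ((‖riemannZeta (1 / 2 + t * Complex.I)‖ ^ 2 : ℝ) : ℂ) *
            Complex.exp (-(δ * t))) -
        2 * Real.pi * Complex.exp (-(δ / 2 * Complex.I)) * rotatedSeries δ‖ ≤ C := by
  obtain ⟨C₁, h₁⟩ := exists_critical_line_bound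
  obtain ⟨C₂, h₂⟩ := exists_contour_shift_bound
  obtain ⟨C₃, h₃⟩ := exists_lower_half_bound
  refine ⟨Real.exp (1 / 4) * (C₁ + C₂ + C₃), fun δ hδ h0 => ?_⟩
  have h₁' := h₁ δ hδ h0
  have h₂' := h₂ δ hδ h0
  have h₃' := h₃ δ hδ h0
  have hfull := integral_gammaKernel_mul_riemannZeta_sq hδ h0
  have hint := integrable_gammaKernel_mul_riemannZeta_sq hδ h0
  rw [← intervalIntegral.integral_Iic_add_Ioi (b := (1 : ℝ)) hint.integrableOn hint.integrableOn] at hfull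
  change _ = 2 * Real.pi * rotatedSeries δ at hfull
  set L : ℂ := ∫ t in Set.Ioi (1 : ℝ), ((‖riemannZeta (1 / 2 + t * Complex.I)‖ ^ 2 : ℝ) : ℂ) *
    Complex.exp (-(δ * t))
  set A : ℂ := ∫ t in Set.Ioi (1 : ℝ), gammaKernel δ ((1 / 2 : ℝ) + t * Complex.I) *
    riemannZeta ((1 / 2 : ℝ) + t * Complex.I) ^ 2
  set B : ℂ := ∫ t in Set.Ioi (1 : ℝ), gammaKernel δ ((3 / 2 : ℝ) + t * Complex.I) *
    riemannZeta ((3 / 2 : ℝ) + t * Complex.I) ^ 2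
  set D : ℂ := ∫ t in Set.Iic (1 : ℝ), gammaKernel δ ((3 / 2 : ℝ) + t * Complex.I) *
    riemannZeta ((3 / 2 : ℝ) + t * Complex.I) ^ 2
  have hunit : Complex.exp (-(δ / 2 * Complex.I)) * Complex.exp (δ / 2 * Complex.I) = 1 := by
    rw [← Complex.exp_add, neg_add_cancel, Complex.exp_zero]
  -- The three errors: replacing |ζ|² by ζ², shifting the contour, and adding the part below height
  -- 1.
  have hdecomp : L - 2 * Real.pi * Complex.exp (-(δ / 2 * Complex.I)) * rotatedSeries δ =
      Complex.exp (-(δ / 2 * Complex.I)) * (-(A - Complex.exp (δ / 2 * Complex.I) * L) +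
        (A - B) - D) := by
    linear_combination -L * hunit - Complex.exp (-(δ / 2 * Complex.I)) * (-hfull)
  have hexp : ‖Complex.exp (-(δ / 2 * Complex.I))‖ ≤ Real.exp (1 / 4) := by
    rw [Complex.norm_exp]
    gcongr
    have := (re_im_bounds hδ).2.2
    simp
    linarith
  rw [hdecomp, norm_mul]
  gcongr
  refine (norm_sub_le _ _).trans (add_le_add ((norm_add_le _ _).trans (add_le_add ?_ h₂')) h₃')
  rwa [norm_neg]

/-! ### From the rotated series to the Lambert series -/

/-- Raise x/a ≤ e^{x/a} to the power a. This trades exponential decay for any chosen power, so that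
the series can be compared with convergent power sums. -/
lemma exp_neg_le_rpow {a x : ℝ} (ha : 0 < a) (hx : 0 < x) :
    Real.exp (-x) ≤ a ^ a * x ^ (-a) := by
  have h1 : x / a ≤ Real.exp (x / a) := by linarith [Real.add_one_le_exp (x / a)]
  have h2 := Real.rpow_le_rpow (by positivity) h1 ha.le
  rw [← Real.exp_mul, div_mul_cancel₀ _ ha.ne', Real.div_rpow hx.le ha.le,
    div_le_iff₀ (by positivity)] at h2
  rw [Real.exp_neg, Real.rpow_neg hx.le, ← div_eq_mul_inv, inv_eq_one_div,
    div_le_div_iff₀ (Real.exp_pos _) (by positivity)]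
  linarith

lemma norm_cexp_neg_sub_cexp_neg_le {A B : ℂ} {m : ℝ} (hA : m ≤ A.re) (hB : m ≤ B.re) :
    ‖Complex.exp (-A) - Complex.exp (-B)‖ ≤ Real.exp (-m) * ‖A - B‖ := by
  have hconv : Convex ℝ {z : ℂ | z.re ≤ -m} := convex_halfSpace_re_le _
  have h := hconv.norm_image_sub_le_of_norm_hasDerivWithin_le (f := Complex.exp)
    (f' := Complex.exp) (C := Real.exp (-m)) (x := -B) (y := -A)
    (fun z _ => (Complex.hasDerivAt_exp z).hasDerivWithinAt) (fun z hz => by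
      rw [Complex.norm_exp]
      exact Real.exp_le_exp.mpr hz) (by simpa using hB) (by simpa using hA)
  refine h.trans (le_of_eq ?_)
  rw [← norm_neg (A - B)]
  congr 2
  ring

/-- The Lambert series `∑ exp(-2πnδ)` over pairs `(m, k)` with `n = mk`. -/
noncomputable def lambertSeries (δ : ℂ) : ℂ :=
  ∑' q : ℕ × ℕ, Complex.exp (-(δ * ((2 * Real.pi * shiftedProd q : ℝ) : ℂ)))

/-- `shiftedProd q` is an integer n, so e^{2πin} = 1 may be inserted. What remains in the exponent
is -2πn · i(e^{-iδ} - 1), close to -2πnδ. -/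
lemma rotated_term_eq (δ : ℂ) (q : ℕ × ℕ) :
    Complex.exp (-(2 * Real.pi * shiftedProd q * Complex.I * Complex.exp (-(δ * Complex.I)))) =
      Complex.exp (-(((2 * Real.pi * shiftedProd q : ℝ) : ℂ) *
        (Complex.I * (Complex.exp (-(δ * Complex.I)) - 1)))) := by
  have h : Complex.exp (((q.1 + 1) * (q.2 + 1) : ℕ) * (2 * Real.pi * Complex.I)) = 1 :=
    Complex.exp_nat_mul_two_pi_mul_I _
  have h' := congrArg
    (Complex.exp (-(2 * Real.pi * shiftedProd q * Complex.I * Complex.exp (-(δ * Complex.I)))) * ·) h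
  simp only [mul_one] at h'
  rw [← h', ← Complex.exp_add]
  congr 1
  unfold shiftedProd
  push_cast
  ring

lemma norm_rotation_sub_le {δ : ℂ} (hδ : ‖δ‖ ≤ 1 / 2) :
    ‖Complex.I * (Complex.exp (-(δ * Complex.I)) - 1) - δ‖ ≤ ‖δ‖ ^ 2 := by
  have hn : ‖-(δ * Complex.I)‖ = ‖δ‖ := by simp
  have h := Complex.norm_exp_sub_one_sub_id_le (x := -(δ * Complex.I)) (by rw [hn]; linarith)
  rw [hn] at h
  have heq : Complex.I * (Complex.exp (-(δ * Complex.I)) - 1) - δ =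
      Complex.I * (Complex.exp (-(δ * Complex.I)) - 1 - -(δ * Complex.I)) := by
    linear_combination -δ * Complex.I_sq
  rw [heq, norm_mul, Complex.norm_I, one_mul]
  exact h

/-- The real part is e^{Im δ} sin(Re δ), and the two factors are at least 1/2 and (15/16) Re δ. The
rotated terms thus decay at a rate comparable to Re δ. -/
lemma le_re_rotation {δ : ℂ} (hδ : ‖δ‖ ≤ 1 / 2) (h0 : 0 < δ.re) :
    δ.re / 3 ≤ (Complex.I * (Complex.exp (-(δ * Complex.I)) - 1)).re := by
  obtain ⟨⟨-, ha⟩, hb, -⟩ := re_im_bounds hδ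
  have hre : (Complex.I * (Complex.exp (-(δ * Complex.I)) - 1)).re =
      Real.exp δ.im * Real.sin δ.re := by
    simp [Complex.exp_im]
  have hsin := Real.sin_gt_sub_cube h0
  have hexp : 1 / 2 ≤ Real.exp δ.im := by linarith [Real.add_one_le_exp δ.im]
  have hsin2 : δ.re * (15 / 16) ≤ Real.sin δ.re := by
    refine le_trans ?_ hsin.le
    nlinarith [mul_nonneg h0.le (mul_nonneg (sub_nonneg.mpr ha) (by linarith : 0 ≤ 1 / 2 + δ.re))]
  rw [hre]
  nlinarith

/-- Serves the Lambert series with c = 1 and the rotated one with c = 1/3; the threshold 1/3 is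
where π > 3 still gives 2πc ≥ 1. -/
lemma exp_neg_two_pi_shiftedProd_le {a c σ : ℝ} (ha : 0 < a) (hc : 1 / 3 ≤ c) (hσ : 0 < σ)
    (q : ℕ × ℕ) :
    Real.exp (-(2 * Real.pi * shiftedProd q * (c * σ))) ≤
      a ^ a * σ ^ (-a) * shiftedProd q ^ (-a) := by
  have hq := shiftedProd_pos q
  have h := exp_neg_le_rpow ha (mul_pos hσ hq)
  rw [Real.mul_rpow hσ.le hq.le, ← mul_assoc] at h
  refine le_trans (Real.exp_le_exp.mpr (neg_le_neg ?_)) h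
  have : 1 ≤ 2 * Real.pi * c := by nlinarith [Real.pi_gt_three]
  nlinarith [mul_pos hσ hq]

/-- Any exponent above 1 makes the sum over pairs converge; 9/8 is a convenient choice. -/
lemma exists_norm_lambertSeries_le :
    ∃ C : ℝ, 0 ≤ C ∧ ∀ δ : ℂ, 0 < δ.re → ‖lambertSeries δ‖ ≤ C * δ.re ^ (-(9 / 8) : ℝ) := by
  have hS := summable_shiftedProd_rpow (a := 9 / 8) (by norm_num)
  refine ⟨(9 / 8 : ℝ) ^ (9 / 8 : ℝ) * ∑' q, shiftedProd q ^ (-(9 / 8) : ℝ),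
    mul_nonneg (by positivity) (tsum_nonneg fun q => Real.rpow_nonneg (shiftedProd_pos q).le _),
    fun δ h0 => ?_⟩
  rw [mul_right_comm, ← tsum_mul_left]
  refine tsum_of_norm_bounded (hS.mul_left _).hasSum fun q => ?_
  have := exp_neg_two_pi_shiftedProd_le (a := 9 / 8) (c := 1) (by norm_num) (by norm_num) h0 q
  refine le_trans (le_of_eq ?_) this
  rw [Complex.norm_exp]
  simp
  ring

lemma norm_rotated_term_le {δ : ℂ} (hδ : ‖δ‖ ≤ 1 / 2) (h0 : 0 < δ.re) (q : ℕ × ℕ) :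
    ‖Complex.exp (-(2 * Real.pi * shiftedProd q * Complex.I * Complex.exp (-(δ * Complex.I))))‖ ≤
      (9 / 8 : ℝ) ^ (9 / 8 : ℝ) * δ.re ^ (-(9 / 8) : ℝ) * shiftedProd q ^ (-(9 / 8) : ℝ) := by
  refine le_trans ?_ (exp_neg_two_pi_shiftedProd_le (a := 9 / 8) (c := 1 / 3) (by norm_num)
    le_rfl h0 q)
  rw [rotated_term_eq, Complex.norm_exp]
  have h := le_re_rotation hδ h0
  have hq := shiftedProd_pos q
  rw [Complex.neg_re, Complex.re_ofReal_mul]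
  gcongr
  linarith

lemma exists_norm_rotatedSeries_le :
    ∃ C : ℝ, 0 ≤ C ∧ ∀ δ : ℂ, ‖δ‖ ≤ 1 / 2 → 0 < δ.re →
      ‖rotatedSeries δ‖ ≤ C * δ.re ^ (-(9 / 8) : ℝ) := by
  have hS := summable_shiftedProd_rpow (a := 9 / 8) (by norm_num)
  refine ⟨(9 / 8 : ℝ) ^ (9 / 8 : ℝ) * ∑' q, shiftedProd q ^ (-(9 / 8) : ℝ),
    mul_nonneg (by positivity) (tsum_nonneg fun q => Real.rpow_nonneg (shiftedProd_pos q).le _),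
    fun δ hδ h0 => ?_⟩
  rw [mul_right_comm, ← tsum_mul_left]
  exact tsum_of_norm_bounded (hS.mul_left _).hasSum fun q => norm_rotated_term_le hδ h0 q

lemma summable_lambert_terms {δ : ℂ} (h0 : 0 < δ.re) :
    Summable fun q : ℕ × ℕ => Real.exp (-(δ.re * (2 * Real.pi * shiftedProd q))) := by
  have hS := summable_shiftedProd_rpow (a := 9 / 8) (by norm_num)
  refine Summable.of_nonneg_of_le (fun q => (Real.exp_pos _).le) (fun q => ?_)
    (hS.mul_left ((9 / 8 : ℝ) ^ (9 / 8 : ℝ) * δ.re ^ (-(9 / 8) : ℝ)))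
  have := exp_neg_two_pi_shiftedProd_le (a := 9 / 8) (c := 1) (by norm_num) (by norm_num) h0 q
  refine le_trans (le_of_eq ?_) this
  ring_nf

/-- Corresponding exponents differ by at most 2πn‖δ‖². The extra n is paid for by raising the power
of 1/Re δ from 9/8 to 17/8. -/
lemma exists_norm_rotatedSeries_sub_lambertSeries_le :
    ∃ C : ℝ, 0 ≤ C ∧ ∀ δ : ℂ, ‖δ‖ ≤ 1 / 2 → 0 < δ.re →
      ‖rotatedSeries δ - lambertSeries δ‖ ≤ C * (‖δ‖ ^ 2 * δ.re ^ (-(17 / 8) : ℝ)) := by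
  have hS := summable_shiftedProd_rpow (a := 9 / 8) (by norm_num)
  refine ⟨2 * Real.pi * (17 / 8 : ℝ) ^ (17 / 8 : ℝ) * ∑' q, shiftedProd q ^ (-(9 / 8) : ℝ),
    mul_nonneg (by positivity) (tsum_nonneg fun q => Real.rpow_nonneg (shiftedProd_pos q).le _),
    fun δ hδ h0 => ?_⟩
  have hsr : Summable fun q : ℕ × ℕ => Complex.exp
      (-(2 * Real.pi * shiftedProd q * Complex.I * Complex.exp (-(δ * Complex.I)))) :=
    Summable.of_norm_bounded (hS.mul_left _) fun q => norm_rotated_term_le hδ h0 q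
  have hsl : Summable fun q : ℕ × ℕ =>
      Complex.exp (-(δ * ((2 * Real.pi * shiftedProd q : ℝ) : ℂ))) := by
    refine Summable.of_norm_bounded (summable_lambert_terms h0) fun q => ?_
    rw [Complex.norm_exp, Complex.neg_re, Complex.re_mul_ofReal]
  rw [rotatedSeries, lambertSeries, ← hsr.tsum_sub hsl, mul_right_comm, ← tsum_mul_left]
  refine tsum_of_norm_bounded (hS.mul_left _).hasSum fun q => ?_
  have hq := shiftedProd_pos q
  rw [rotated_term_eq]
  have hx : 0 < 2 * Real.pi * shiftedProd q := by positivity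
  refine (norm_cexp_neg_sub_cexp_neg_le (m := 2 * Real.pi * shiftedProd q * (1 / 3 * δ.re))
    ?_ ?_).trans ?_
  · rw [Complex.re_ofReal_mul]
    gcongr
    linarith [le_re_rotation hδ h0]
  · rw [Complex.re_mul_ofReal, mul_comm]
    gcongr
    linarith
  · have h1 := exp_neg_two_pi_shiftedProd_le (a := 17 / 8) (c := 1 / 3) (by norm_num) le_rfl h0 q
    have h2 : ‖((2 * Real.pi * shiftedProd q : ℝ) : ℂ) *
        (Complex.I * (Complex.exp (-(δ * Complex.I)) - 1)) -
        δ * ((2 * Real.pi * shiftedProd q : ℝ) : ℂ)‖ ≤ 2 * Real.pi * shiftedProd q * ‖δ‖ ^ 2 := by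
      rw [mul_comm δ ((2 * Real.pi * shiftedProd q : ℝ) : ℂ), ← mul_sub, norm_mul, Complex.norm_real,
        Real.norm_of_nonneg hx.le]
      gcongr
      exact norm_rotation_sub_le hδ
    have h3 : shiftedProd q ^ (-(9 / 8) : ℝ) = shiftedProd q ^ (-(17 / 8) : ℝ) * shiftedProd q := by
      rw [show (-(9 / 8) : ℝ) = -(17 / 8) + 1 by norm_num, Real.rpow_add hq, Real.rpow_one]
    refine (mul_le_mul h1 h2 (norm_nonneg _) ?_).trans (le_of_eq ?_)
    · positivity
    · rw [h3]
      ring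

/-! ### Comparison of the two Laplace transforms -/

/-- The Laplace transform of `|ζ(1/2 + it)|²` restricted to `t > 1`. -/
noncomputable def zetaLaplace (δ : ℂ) : ℂ :=
  ∫ t in Set.Ioi (1 : ℝ), ((‖riemannZeta (1 / 2 + t * Complex.I)‖ ^ 2 : ℝ) : ℂ) *
    Complex.exp (-(δ * t))

open MeasureTheory in
lemma norm_zetaLaplace_le {δ : ℂ} (h0 : 0 < δ.re) : ‖zetaLaplace δ‖ ≤ ‖zetaLaplace δ.re‖ := by
  have hre : zetaLaplace δ.re = ((∫ t in Set.Ioi (1 : ℝ),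
      ‖riemannZeta (1 / 2 + t * Complex.I)‖ ^ 2 * Real.exp (-(δ.re * t)) : ℝ) : ℂ) := by
    rw [zetaLaplace, ← integral_complex_ofReal]
    push_cast
    rfl
  rw [hre, Complex.norm_real]
  refine le_trans ?_ (le_abs_self _)
  refine norm_integral_le_of_norm_le (integrableOn_riemannZeta_sq_mul_exp h0)
    (Eventually.of_forall fun t => ?_)
  rw [norm_mul, Complex.norm_real, Complex.norm_exp, Real.norm_of_nonneg (by positivity)]
  simp

/-- The comparison with the rotated series needs small δ, but positivity of |ζ|² reduces every δ to
its real part, so Im δ may be arbitrary. -/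
lemma exists_norm_zetaLaplace_le :
    ∃ C : ℝ, 0 ≤ C ∧ ∀ δ : ℂ, 0 < δ.re → δ.re ≤ 1 / 2 →
      ‖zetaLaplace δ‖ ≤ C * δ.re ^ (-(9 / 8) : ℝ) := by
  obtain ⟨C₁, h₁⟩ := exists_laplace_sub_rotatedSeries_bound
  obtain ⟨C₂, hC₂, h₂⟩ := exists_norm_rotatedSeries_le
  have hC₁ : 0 ≤ C₁ := (norm_nonneg _).trans (h₁ (1 / 2 : ℝ)
    (by rw [Complex.norm_real]; norm_num) (by norm_num))
  refine ⟨C₁ + 2 * Real.pi * C₂, by positivity, fun δ h0 h1 => (norm_zetaLaplace_le h0).trans ?_⟩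
  have hn : ‖(δ.re : ℂ)‖ ≤ 1 / 2 := by rwa [Complex.norm_real, Real.norm_of_nonneg h0.le]
  have ha := h₁ δ.re hn (by simpa using h0)
  have hb := h₂ δ.re hn (by simpa using h0)
  rw [Complex.ofReal_re] at hb
  have hone : 1 ≤ δ.re ^ (-(9 / 8) : ℝ) :=
    Real.one_le_rpow_of_pos_of_le_one_of_nonpos h0 (by linarith) (by norm_num)
  have hu : ‖Complex.exp (-((δ.re : ℂ) / 2 * Complex.I))‖ = 1 := by
    rw [Complex.norm_exp]
    simp
  have hp : ‖2 * (Real.pi : ℂ)‖ = 2 * Real.pi := by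
    rw [norm_mul, Complex.norm_real, Real.norm_of_nonneg Real.pi_pos.le]
    simp
  have := norm_le_norm_add_norm_sub' (zetaLaplace δ.re)
    (2 * Real.pi * Complex.exp (-((δ.re : ℂ) / 2 * Complex.I)) * rotatedSeries δ.re)
  rw [norm_mul, norm_mul, hu, hp, mul_one] at this
  refine this.trans ?_
  have hc : 2 * Real.pi * ‖rotatedSeries δ.re‖ ≤ 2 * Real.pi * (C₂ * δ.re ^ (-(9 / 8) : ℝ)) := by
    gcongr
  have hd : C₁ ≤ C₁ * δ.re ^ (-(9 / 8) : ℝ) := le_mul_of_one_le_right hC₁ hone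
  change ‖zetaLaplace δ.re - _‖ ≤ C₁ at ha
  linarith

/-- The two Laplace transforms agree up to a power saving. -/
theorem exists_norm_zetaLaplace_sub_lambertSeries_le :
    ∃ C : ℝ, 0 ≤ C ∧ ∀ δ : ℂ, 0 < δ.re → δ.re ≤ 1 / 4 →
      ‖zetaLaplace δ - 2 * Real.pi * lambertSeries δ‖ ≤
        C * (δ.re ^ (-(11 / 8) : ℝ) * ‖δ‖ ^ (1 / 2 : ℝ)) := by
  obtain ⟨C₁, h₁⟩ := exists_laplace_sub_rotatedSeries_bound
  obtain ⟨C₂, hC₂, h₂⟩ := exists_norm_rotatedSeries_le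
  obtain ⟨C₃, hC₃, h₃⟩ := exists_norm_rotatedSeries_sub_lambertSeries_le
  obtain ⟨C₄, hC₄, h₄⟩ := exists_norm_zetaLaplace_le
  obtain ⟨C₅, hC₅, h₅⟩ := exists_norm_lambertSeries_le
  have hC₁ : 0 ≤ C₁ := (norm_nonneg _).trans (h₁ (1 / 2 : ℝ)
    (by rw [Complex.norm_real]; norm_num) (by norm_num))
  have hp : ‖2 * (Real.pi : ℂ)‖ = 2 * Real.pi := by
    rw [norm_mul, Complex.norm_real, Real.norm_of_nonneg Real.pi_pos.le]
    simp
  refine ⟨(C₁ + 2 * Real.pi * C₂ + 2 * Real.pi * C₃) + (C₄ + 2 * Real.pi * C₅), by positivity,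
    fun δ h0 h1 => ?_⟩
  set σ := δ.re with hσ
  set d := ‖δ‖ with hd
  have hσd : σ ≤ d := Complex.re_le_norm δ
  have hd0 : 0 < d := h0.trans_le hσd
  have hσ1 : σ ≤ 1 := by linarith
  set X := σ ^ (-(11 / 8) : ℝ) * d ^ (1 / 2 : ℝ) with hX
  have hX0 : 0 ≤ X := by positivity
  -- If |δ|² ≤ σ, then σ ≤ 1/4 gives |δ| ≤ 1/2 and the rotation is a small perturbation. Otherwise
  -- each transform is O(σ^{-9/8}) and |δ|^{1/2} > σ^{1/4}; this is where 11/8 = 9/8 + 1/4 comes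
  -- from.
  rcases le_or_gt (d ^ 2) σ with hcase | hcase
  · have hδ : ‖δ‖ ≤ 1 / 2 := by
      rw [← hd]
      nlinarith
    have hdσ : d ≤ σ ^ (1 / 2 : ℝ) := by
      rw [← Real.sqrt_eq_rpow]
      exact Real.le_sqrt_of_sq_le hcase
    have e1 : 1 ≤ X := by
      have : σ ^ (-(11 / 8) : ℝ) * σ ^ (1 / 2 : ℝ) ≤ X := by
        rw [hX]
        gcongr
      rw [← Real.rpow_add h0] at this
      refine le_trans ?_ this
      exact Real.one_le_rpow_of_pos_of_le_one_of_nonpos h0 hσ1 (by norm_num)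
    have e2 : d * σ ^ (-(9 / 8) : ℝ) ≤ X := by
      have ha : d = d ^ (1 / 2 : ℝ) * d ^ (1 / 2 : ℝ) := by
        rw [← Real.rpow_add hd0]
        norm_num
      have hb : d ^ (1 / 2 : ℝ) ≤ σ ^ (1 / 4 : ℝ) := by
        refine (Real.rpow_le_rpow hd0.le hdσ (by norm_num)).trans (le_of_eq ?_)
        rw [← Real.rpow_mul h0.le]
        norm_num
      calc d * σ ^ (-(9 / 8) : ℝ) = d ^ (1 / 2 : ℝ) * d ^ (1 / 2 : ℝ) * σ ^ (-(9 / 8) : ℝ) := by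
            rw [← ha]
        _ ≤ d ^ (1 / 2 : ℝ) * σ ^ (1 / 4 : ℝ) * σ ^ (-(9 / 8) : ℝ) := by gcongr
        _ = d ^ (1 / 2 : ℝ) * σ ^ (-(7 / 8) : ℝ) := by
            rw [mul_assoc, ← Real.rpow_add h0]
            norm_num
        _ ≤ d ^ (1 / 2 : ℝ) * σ ^ (-(11 / 8) : ℝ) := by
            gcongr ?_ * ?_
            exact Real.rpow_le_rpow_of_exponent_ge h0 hσ1 (by norm_num)
        _ = X := by rw [hX, mul_comm]
    have e3 : d ^ 2 * σ ^ (-(17 / 8) : ℝ) ≤ X := by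
      have ha : d ^ 2 = d ^ (1 / 2 : ℝ) * d ^ (3 / 2 : ℝ) := by
        rw [← Real.rpow_add hd0, ← Real.rpow_natCast]
        norm_num
      have hb : d ^ (3 / 2 : ℝ) ≤ σ ^ (3 / 4 : ℝ) := by
        refine (Real.rpow_le_rpow hd0.le hdσ (by norm_num)).trans (le_of_eq ?_)
        rw [← Real.rpow_mul h0.le]
        norm_num
      calc d ^ 2 * σ ^ (-(17 / 8) : ℝ) = d ^ (1 / 2 : ℝ) * d ^ (3 / 2 : ℝ) * σ ^ (-(17 / 8) : ℝ) := by
            rw [← ha]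
        _ ≤ d ^ (1 / 2 : ℝ) * σ ^ (3 / 4 : ℝ) * σ ^ (-(17 / 8) : ℝ) := by gcongr
        _ = X := by
            rw [mul_assoc, ← Real.rpow_add h0, hX, mul_comm]
            norm_num
    have hexp : ‖Complex.exp (-(δ / 2 * Complex.I)) - 1‖ ≤ d := by
      have hn : ‖-(δ / 2 * Complex.I)‖ = d / 2 := by simp [hd]
      have := Complex.norm_exp_sub_one_le (x := -(δ / 2 * Complex.I)) (by rw [hn]; linarith)
      rw [hn] at this
      linarith
    have hdec : zetaLaplace δ - 2 * Real.pi * lambertSeries δ =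
        (zetaLaplace δ - 2 * Real.pi * Complex.exp (-(δ / 2 * Complex.I)) * rotatedSeries δ) +
        2 * Real.pi * ((Complex.exp (-(δ / 2 * Complex.I)) - 1) * rotatedSeries δ) +
        2 * Real.pi * (rotatedSeries δ - lambertSeries δ) := by ring
    have f1 := h₁ δ hδ h0
    change ‖zetaLaplace δ - _‖ ≤ C₁ at f1
    have f2 : ‖2 * Real.pi * ((Complex.exp (-(δ / 2 * Complex.I)) - 1) * rotatedSeries δ)‖ ≤
        2 * Real.pi * C₂ * X := by
      rw [norm_mul (2 * (Real.pi : ℂ)), norm_mul (_ - 1), hp, mul_assoc (2 * Real.pi)]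
      refine mul_le_mul_of_nonneg_left ?_ (by positivity)
      calc _ ≤ d * (C₂ * σ ^ (-(9 / 8) : ℝ)) := by
            gcongr
            exact h₂ δ hδ h0
        _ = C₂ * (d * σ ^ (-(9 / 8) : ℝ)) := by ring
        _ ≤ _ := by gcongr
    have f3 : ‖2 * Real.pi * (rotatedSeries δ - lambertSeries δ)‖ ≤ 2 * Real.pi * C₃ * X := by
      rw [norm_mul, hp, mul_assoc (2 * Real.pi)]
      refine mul_le_mul_of_nonneg_left ?_ (by positivity)
      exact (h₃ δ hδ h0).trans (mul_le_mul_of_nonneg_left e3 hC₃)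
    rw [hdec]
    refine (norm_add₃_le).trans ?_
    have : C₁ ≤ C₁ * X := le_mul_of_one_le_right hC₁ e1
    have : 0 ≤ (C₄ + 2 * Real.pi * C₅) * X := by positivity
    nlinarith
  · have e4 : σ ^ (-(9 / 8) : ℝ) ≤ X := by
      have : σ ^ (1 / 4 : ℝ) ≤ d ^ (1 / 2 : ℝ) := by
        refine (Real.rpow_le_rpow h0.le hcase.le (by norm_num)).trans (le_of_eq ?_)
        rw [← Real.rpow_natCast, ← Real.rpow_mul hd0.le]
        norm_num
      calc σ ^ (-(9 / 8) : ℝ) = σ ^ (-(11 / 8) : ℝ) * σ ^ (1 / 4 : ℝ) := by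
            rw [← Real.rpow_add h0]
            norm_num
        _ ≤ X := by
            rw [hX]
            gcongr
    refine (norm_sub_le _ _).trans ?_
    rw [norm_mul, hp]
    have g1 := (h₄ δ h0 (by linarith)).trans (mul_le_mul_of_nonneg_left e4 hC₄)
    have g2 := mul_le_mul_of_nonneg_left ((h₅ δ h0).trans (mul_le_mul_of_nonneg_left e4 hC₅))
      (by positivity : 0 ≤ 2 * Real.pi)
    have : 0 ≤ (C₁ + 2 * Real.pi * C₂ + 2 * Real.pi * C₃) * X := by positivity
    nlinarith

/-! ### Tauberian argument: from Laplace transforms to distribution functions -/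

section Tauberian

open MeasureTheory

variable {α β : Type*} [MeasurableSpace α] [MeasurableSpace β]

lemma integrable_max_sub {μ : Measure α} {p : α → ℝ} (hp : Measurable p) {σ : ℝ} (hσ : 0 < σ)
    (hint : Integrable (fun a => Real.exp (-(σ * p a))) μ) (T : ℝ) :
    Integrable (fun a => max (T - p a) 0) μ := by
  refine (hint.const_mul (Real.exp (σ * T) / σ)).mono'
    ((measurable_const.sub hp).max measurable_const).aestronglyMeasurable
    (Eventually.of_forall fun a => ?_)
  rw [Real.norm_of_nonneg (le_max_right _ _), div_mul_eq_mul_div, ← Real.exp_add, le_div_iff₀ hσ]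
  rcases le_total (T - p a) 0 with h | h
  · rw [max_eq_right h, zero_mul]
    exact (Real.exp_pos _).le
  · rw [max_eq_left h]
    have := Real.add_one_le_exp (σ * T + -(σ * p a))
    linarith

lemma measure_sublevel_lt_top {μ : Measure α} {p : α → ℝ} {σ : ℝ} (hσ : 0 < σ)
    (hint : Integrable (fun a => Real.exp (-(σ * p a))) μ) (T : ℝ) :
    μ {a | p a ≤ T} < ⊤ := by
  refine lt_of_le_of_lt (measure_mono fun a ha => ?_)
    (hint.measure_ge_lt_top (Real.exp_pos (-(σ * T))))
  have : p a ≤ T := ha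
  exact Real.exp_le_exp.mpr (by nlinarith)

lemma integral_indicator_sublevel {μ : Measure α} {p : α → ℝ} (hp : Measurable p) (H T : ℝ) :
    ∫ a, {a | p a ≤ T}.indicator (fun _ => H) a ∂μ = μ.real {a | p a ≤ T} * H := by
  rw [integral_indicator (measurableSet_le hp measurable_const), setIntegral_const, smul_eq_mul]

/-- The pointwise bound H·1{p ≤ T} ≤ (T + H - p)⁺ - (T - p)⁺. With `le_sublevel_mul` it traps the
distribution function between difference quotients of its integral. -/
lemma sublevel_mul_le {μ : Measure α} {p : α → ℝ} (hp : Measurable p) {σ : ℝ} (hσ : 0 < σ)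
    (hint : Integrable (fun a => Real.exp (-(σ * p a))) μ) (T : ℝ) {H : ℝ} (hH : 0 ≤ H) :
    μ.real {a | p a ≤ T} * H ≤
      (∫ a, max (T + H - p a) 0 ∂μ) - ∫ a, max (T - p a) 0 ∂μ := by
  rw [← integral_sub (integrable_max_sub hp hσ hint _) (integrable_max_sub hp hσ hint _),
    ← integral_indicator_sublevel hp]
  refine integral_mono ?_ ((integrable_max_sub hp hσ hint _).sub (integrable_max_sub hp hσ hint _))
    fun a => ?_
  · exact (integrable_indicator_iff (measurableSet_le hp measurable_const)).mpr
      (integrableOn_const (measure_sublevel_lt_top hσ hint T).ne)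
  · by_cases h : p a ≤ T
    · rw [Set.indicator_of_mem (show a ∈ {a | p a ≤ T} from h),
        max_eq_left (by linarith), max_eq_left (by linarith)]
      linarith
    · rw [Set.indicator_of_notMem (show a ∉ {a | p a ≤ T} from h), sub_nonneg]
      exact max_le_max_right _ (by linarith)

lemma le_sublevel_mul {μ : Measure α} {p : α → ℝ} (hp : Measurable p) {σ : ℝ} (hσ : 0 < σ)
    (hint : Integrable (fun a => Real.exp (-(σ * p a))) μ) (T H : ℝ) :
    (∫ a, max (T + H - p a) 0 ∂μ) - ∫ a, max (T - p a) 0 ∂μ ≤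
      μ.real {a | p a ≤ T + H} * H := by
  rw [← integral_sub (integrable_max_sub hp hσ hint _) (integrable_max_sub hp hσ hint _),
    ← integral_indicator_sublevel hp]
  refine integral_mono ((integrable_max_sub hp hσ hint _).sub (integrable_max_sub hp hσ hint _)) ?_
    fun a => ?_
  · exact (integrable_indicator_iff (measurableSet_le hp measurable_const)).mpr
      (integrableOn_const (measure_sublevel_lt_top hσ hint (T + H)).ne)
  · by_cases h : p a ≤ T + H
    · rw [Set.indicator_of_mem (show a ∈ {a | p a ≤ T + H} from h),
        max_eq_left (by linarith)]
      linarith [le_max_left (T - p a) 0]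
    · rw [Set.indicator_of_notMem (show a ∉ {a | p a ≤ T + H} from h), sub_nonpos,
        max_eq_right (by linarith)]
      exact le_max_right _ _

lemma norm_perron_kernel (σ T u : ℝ) :
    ‖Complex.exp ((σ + u * Complex.I) * T) / (σ + u * Complex.I) ^ 2‖ =
      Real.exp (σ * T) * ‖(σ : ℂ) + u * Complex.I‖ ^ (-2 : ℝ) := by
  rw [norm_div, norm_pow, Complex.norm_exp, Real.rpow_neg (norm_nonneg _), Real.rpow_ofNat]
  simp [div_eq_mul_inv]

lemma integrable_laplace_mul_kernel {μ : Measure α} [SFinite μ] {p : α → ℝ} (hp : Measurable p)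
    {σ : ℝ} (hσ : 0 < σ) (hint : Integrable (fun a => Real.exp (-(σ * p a))) μ) (T : ℝ) :
    Integrable fun u : ℝ => (∫ a, Complex.exp (-((σ + u * Complex.I) * p a)) ∂μ) *
      (Complex.exp ((σ + u * Complex.I) * T) / (σ + u * Complex.I) ^ 2) := by
  refine ((integrable_norm_rpow_add_mul_I hσ (r := 2) (by norm_num)).const_mul
    ((∫ a, Real.exp (-(σ * p a)) ∂μ) * Real.exp (σ * T))).mono' ?_ (Eventually.of_forall fun u => ?_)
  · refine AEStronglyMeasurable.mul ?_ ?_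
    · refine StronglyMeasurable.aestronglyMeasurable (StronglyMeasurable.integral_prod_right
        (f := fun (u : ℝ) (a : α) => Complex.exp (-((σ + u * Complex.I) * p a))) ?_)
      refine Measurable.stronglyMeasurable ?_
      have : Measurable fun z : ℝ × α => p z.2 := hp.comp measurable_snd
      unfold Function.uncurry
      fun_prop
    · exact Measurable.aestronglyMeasurable (by fun_prop)
  · rw [norm_mul, norm_perron_kernel, ← mul_assoc]
    gcongr
    refine norm_integral_le_of_norm_le hint (Eventually.of_forall fun a => ?_)
    rw [Complex.norm_exp]
    simp

/-- Perron's formula with σ = 1/T, so that e^{σT} = e and T ≥ 4 means σ ≤ 1/4. Kernel and error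
combine to |s|^{-3/2}, still integrable, and σ^{-11/8} · σ^{-1/2} = T^{15/8}. -/
lemma exists_integral_max_sub_sub_le {μ : Measure α} {ν : Measure β} [SFinite μ] [SFinite ν]
    {p : α → ℝ} {q : β → ℝ} (hp : Measurable p) (hq : Measurable q)
    (hμ : ∀ σ : ℝ, 0 < σ → Integrable (fun a => Real.exp (-(σ * p a))) μ)
    (hν : ∀ σ : ℝ, 0 < σ → Integrable (fun b => Real.exp (-(σ * q b))) ν)
    {C : ℝ} (hC : ∀ σ : ℝ, 0 < σ → σ ≤ 1 / 4 → ∀ u : ℝ,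
      ‖(∫ a, Complex.exp (-((σ + u * Complex.I) * p a)) ∂μ) -
        ∫ b, Complex.exp (-((σ + u * Complex.I) * q b)) ∂ν‖ ≤
          C * (σ ^ (-(11 / 8) : ℝ) * ‖(σ : ℂ) + u * Complex.I‖ ^ (1 / 2 : ℝ))) :
    ∃ D : ℝ, 0 ≤ D ∧ ∀ T : ℝ, 4 ≤ T →
      |(∫ a, max (T - p a) 0 ∂μ) - ∫ b, max (T - q b) 0 ∂ν| ≤ D * T ^ (15 / 8 : ℝ) := by
  set J : ℝ := ∫ u : ℝ, (1 + ‖u‖ ^ 2) ^ (-(3 / 2) / 2 : ℝ)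
  suffices h : ∃ D : ℝ, ∀ T : ℝ, 4 ≤ T →
      |(∫ a, max (T - p a) 0 ∂μ) - ∫ b, max (T - q b) 0 ∂ν| ≤ D * T ^ (15 / 8 : ℝ) by
    obtain ⟨D, hD⟩ := h
    refine ⟨|D|, abs_nonneg _, fun T hT => (hD T hT).trans ?_⟩
    gcongr
    exact le_abs_self D
  refine ⟨1 / (2 * Real.pi) * (C * Real.exp 1 * J), fun T hT => ?_⟩
  have hT0 : 0 < T := by linarith
  set σ : ℝ := 1 / T with hσdef
  have hσ : 0 < σ := by positivity
  have hσ4 : σ ≤ 1 / 4 := one_div_le_one_div_of_le (by norm_num) hT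
  have hσT : σ * T = 1 := by rw [hσdef]; field_simp
  have h1 := integral_max_sub_eq μ hp hσ (hμ σ hσ) T
  have h2 := integral_max_sub_eq ν hq hσ (hν σ hσ) T
  have hdom : Integrable fun u : ℝ => C * Real.exp 1 * σ ^ (-(11 / 8) : ℝ) *
      ‖(σ : ℂ) + u * Complex.I‖ ^ (-(3 / 2) : ℝ) :=
    (integrable_norm_rpow_add_mul_I hσ (by norm_num)).const_mul _
  have hw : ∀ u : ℝ, ‖Complex.exp ((σ + u * Complex.I) * T) / (σ + u * Complex.I) ^ 2‖ =
      Real.exp 1 * ‖(σ : ℂ) + u * Complex.I‖ ^ (-2 : ℝ) := fun u => by rw [norm_perron_kernel, hσT]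
  have h3 : 2 * Real.pi * (((∫ a, max (T - p a) 0 ∂μ) - ∫ b, max (T - q b) 0 ∂ν : ℝ) : ℂ) =
      ∫ u : ℝ, ((∫ a, Complex.exp (-((σ + u * Complex.I) * p a)) ∂μ) -
        ∫ b, Complex.exp (-((σ + u * Complex.I) * q b)) ∂ν) *
        (Complex.exp ((σ + u * Complex.I) * T) / (σ + u * Complex.I) ^ 2) := by
    simp_rw [sub_mul]
    rw [integral_sub (integrable_laplace_mul_kernel hp hσ (hμ σ hσ) T)
      (integrable_laplace_mul_kernel hq hσ (hν σ hσ) T), ← h1, ← h2]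
    push_cast
    ring
  have h4 : 2 * Real.pi * |(∫ a, max (T - p a) 0 ∂μ) - ∫ b, max (T - q b) 0 ∂ν| ≤
      ∫ u : ℝ, C * Real.exp 1 * σ ^ (-(11 / 8) : ℝ) *
        ‖(σ : ℂ) + u * Complex.I‖ ^ (-(3 / 2) : ℝ) := by
    have hn : ‖2 * (Real.pi : ℂ) * (((∫ a, max (T - p a) 0 ∂μ) -
        ∫ b, max (T - q b) 0 ∂ν : ℝ) : ℂ)‖ =
        2 * Real.pi * |(∫ a, max (T - p a) 0 ∂μ) - ∫ b, max (T - q b) 0 ∂ν| := by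
      rw [norm_mul, norm_mul, Complex.norm_real, Complex.norm_real,
        Real.norm_of_nonneg Real.pi_pos.le, Real.norm_eq_abs]
      simp
    rw [← hn, h3]
    refine norm_integral_le_of_norm_le hdom (Eventually.of_forall fun u => ?_)
    rw [norm_mul, hw]
    have hpos : 0 < ‖(σ : ℂ) + u * Complex.I‖ := norm_pos_iff.mpr (add_mul_I_ne_zero hσ u)
    refine (mul_le_mul_of_nonneg_right (hC σ hσ hσ4 u) (by positivity)).trans (le_of_eq ?_)
    rw [show (-(3 / 2) : ℝ) = 1 / 2 + -2 by norm_num, Real.rpow_add hpos]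
    ring
  rw [integral_const_mul, integral_norm_rpow_add_mul_I _ hσ] at h4
  have h5 : σ ^ (-(11 / 8) : ℝ) * σ ^ (1 - 3 / 2 : ℝ) = T ^ (15 / 8 : ℝ) := by
    rw [← Real.rpow_add hσ, hσdef, one_div, Real.inv_rpow hT0.le, ← Real.rpow_neg hT0.le]
    norm_num
  have h6 : C * Real.exp 1 * σ ^ (-(11 / 8) : ℝ) * (σ ^ (1 - 3 / 2 : ℝ) * J) =
      C * Real.exp 1 * J * T ^ (15 / 8 : ℝ) := by
    rw [← h5]; ring
  rw [h6] at h4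
  rw [mul_assoc, one_div, inv_mul_eq_div, le_div_iff₀ (by positivity)]
  linarith

/-- If `N(T)/T - log T → A`, the same holds after replacing `T` by a nearby `y(T)` in `N`. -/
lemma tendsto_comp_div_sub_log {N y : ℝ → ℝ} {A : ℝ}
    (hN : Tendsto (fun T => N T / T - Real.log T) atTop (𝓝 A))
    (hy : Tendsto y atTop atTop) (hy1 : Tendsto (fun T => y T / T) atTop (𝓝 1))
    (hy2 : Tendsto (fun T => Real.log T * (y T / T - 1)) atTop (𝓝 0)) :
    Tendsto (fun T => N (y T) / T - Real.log T) atTop (𝓝 A) := by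
  have h1 := (hN.comp hy).mul hy1
  have h2 : Tendsto (fun T => Real.log (y T / T)) atTop (𝓝 0) := by
    have := (Real.continuousAt_log one_ne_zero).tendsto.comp hy1
    rwa [Real.log_one] at this
  have h3 := (h1.add hy2).add (h2.mul hy1)
  simp only [mul_one, add_zero] at h3
  refine h3.congr' ?_
  filter_upwards [eventually_gt_atTop 0, hy.eventually_gt_atTop 0] with T hT hyT
  simp only [Function.comp_apply]
  rw [Real.log_div hyT.ne' hT.ne']
  field_simp
  ring

lemma tendsto_log_mul_rpow_neg {a : ℝ} (ha : 0 < a) :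
    Tendsto (fun T : ℝ => Real.log T * T ^ (-a)) atTop (𝓝 0) := by
  refine (isLittleO_log_rpow_atTop ha).tendsto_div_nhds_zero.congr' ?_
  filter_upwards [eventually_gt_atTop 0] with T hT
  rw [Real.rpow_neg hT.le, div_eq_mul_inv]

lemma rpow_fifteen_sixteenths_div {T : ℝ} (hT : 0 < T) :
    T ^ (15 / 16 : ℝ) / T = T ^ (-(1 / 16) : ℝ) := by
  rw [div_eq_mul_inv, ← Real.rpow_neg_one, ← Real.rpow_add hT]
  norm_num

/-- The relative shift is T^{-1/16}, which still tends to 0 after multiplication by log T. -/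
lemma tendsto_comp_shift_div_sub_log {N : ℝ → ℝ} {A : ℝ} (c : ℝ)
    (hN : Tendsto (fun T => N T / T - Real.log T) atTop (𝓝 A)) :
    Tendsto (fun T : ℝ => N (T + c * T ^ (15 / 16 : ℝ)) / T - Real.log T) atTop (𝓝 A) := by
  have h0 : Tendsto (fun T : ℝ => T ^ (-(1 / 16) : ℝ)) atTop (𝓝 0) :=
    tendsto_rpow_neg_atTop (by norm_num)
  have hratio : ∀ᶠ T : ℝ in atTop, (T + c * T ^ (15 / 16 : ℝ)) / T = 1 + c * T ^ (-(1 / 16) : ℝ) := by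
    filter_upwards [eventually_gt_atTop 0] with T hT
    rw [add_div, div_self hT.ne', mul_div_assoc, rpow_fifteen_sixteenths_div hT]
  have h1 : Tendsto (fun T : ℝ => (T + c * T ^ (15 / 16 : ℝ)) / T) atTop (𝓝 1) := by
    have := (h0.const_mul c).const_add 1
    rw [mul_zero, add_zero] at this
    exact this.congr' (hratio.mono fun T h => h.symm)
  refine tendsto_comp_div_sub_log hN ?_ h1 ?_
  · refine (h1.pos_mul_atTop one_pos tendsto_id).congr' ?_
    filter_upwards [eventually_gt_atTop 0] with T hT
    simp only [id]
    field_simp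
  · have := (tendsto_log_mul_rpow_neg (a := 1 / 16) (by norm_num)).const_mul c
    rw [mul_zero] at this
    refine this.congr' ?_
    filter_upwards [hratio] with T h
    rw [h]
    ring

/-- Two measures whose Laplace transforms are close have asymptotically equal distribution
functions, up to an error `o(T)`. -/
theorem tendsto_sublevel_of_laplace_close {μ : Measure α} {ν : Measure β} [SFinite μ] [SFinite ν]
    {p : α → ℝ} {q : β → ℝ} (hp : Measurable p) (hq : Measurable q)
    (hμ : ∀ σ : ℝ, 0 < σ → Integrable (fun a => Real.exp (-(σ * p a))) μ)
    (hν : ∀ σ : ℝ, 0 < σ → Integrable (fun b => Real.exp (-(σ * q b))) ν)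
    {C : ℝ} (hC : ∀ σ : ℝ, 0 < σ → σ ≤ 1 / 4 → ∀ u : ℝ,
      ‖(∫ a, Complex.exp (-((σ + u * Complex.I) * p a)) ∂μ) -
        ∫ b, Complex.exp (-((σ + u * Complex.I) * q b)) ∂ν‖ ≤
          C * (σ ^ (-(11 / 8) : ℝ) * ‖(σ : ℂ) + u * Complex.I‖ ^ (1 / 2 : ℝ)))
    {A : ℝ} (hN : Tendsto (fun T => ν.real {b | q b ≤ T} / T - Real.log T) atTop (𝓝 A)) :
    Tendsto (fun T => μ.real {a | p a ≤ T} / T - Real.log T) atTop (𝓝 A) := by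
  obtain ⟨D, hD0, hD⟩ := exists_integral_max_sub_sub_le hp hq hμ hν hC
  -- The step H = T^{15/16} balances shift and error: T^{15/8}/H = H = o(T). The factor 2 in E
  -- counts the two smoothed comparisons, and 2^{15/8} allows arguments up to 2T.
  set E : ℝ := 2 * D * 2 ^ (15 / 8 : ℝ) with hE
  have hpow : ∀ T : ℝ, 0 < T → (2 * T) ^ (15 / 8 : ℝ) =
      2 ^ (15 / 8 : ℝ) * T ^ (15 / 16 : ℝ) * T ^ (15 / 16 : ℝ) := by
    intro T hT
    rw [Real.mul_rpow (by norm_num) hT.le, mul_assoc, ← Real.rpow_add hT]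
    norm_num
  have hHle : ∀ T : ℝ, 1 ≤ T → T ^ (15 / 16 : ℝ) ≤ T := by
    intro T hT
    calc T ^ (15 / 16 : ℝ) ≤ T ^ (1 : ℝ) := Real.rpow_le_rpow_of_exponent_le hT (by norm_num)
      _ = T := Real.rpow_one T
  have hbound : ∀ T y : ℝ, 0 < T → 4 ≤ y → y ≤ 2 * T →
      |(∫ a, max (y - p a) 0 ∂μ) - ∫ b, max (y - q b) 0 ∂ν| ≤ D * (2 * T) ^ (15 / 8 : ℝ) := by
    intro T y hT hy hyT
    refine (hD y hy).trans ?_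
    gcongr
  have hup := (tendsto_comp_shift_div_sub_log 1 hN)
  have hlo := (tendsto_comp_shift_div_sub_log (-1) hN)
  have herr : Tendsto (fun T : ℝ => E * T ^ (-(1 / 16) : ℝ)) atTop (𝓝 0) := by
    simpa using (tendsto_rpow_neg_atTop (show (0 : ℝ) < 1 / 16 by norm_num)).const_mul E
  have hup' := hup.add herr
  have hlo' := hlo.sub herr
  rw [add_zero] at hup'
  rw [sub_zero] at hlo'
  have hlarge : ∀ᶠ T : ℝ in atTop, 4 ≤ T + -1 * T ^ (15 / 16 : ℝ) := by
    have h0 : Tendsto (fun T : ℝ => 1 - T ^ (-(1 / 16) : ℝ)) atTop (𝓝 1) := by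
      simpa using (tendsto_rpow_neg_atTop (show (0 : ℝ) < 1 / 16 by norm_num)).const_sub 1
    filter_upwards [(h0.pos_mul_atTop one_pos tendsto_id).eventually_ge_atTop 4,
      eventually_gt_atTop 0] with T hT hT0
    refine hT.trans (le_of_eq ?_)
    rw [← rpow_fifteen_sixteenths_div hT0, id]
    field_simp
    ring
  refine tendsto_of_tendsto_of_tendsto_of_le_of_le' hlo' hup' ?_ ?_
  · filter_upwards [hlarge, eventually_ge_atTop 4] with T hT hT4
    have hT0 : 0 < T := by linarith
    set H := T ^ (15 / 16 : ℝ) with hH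
    have hH0 : 0 < H := by positivity
    have a1 := le_sublevel_mul hp one_pos (hμ 1 one_pos) (T - H) H
    have a2 := sublevel_mul_le hq one_pos (hν 1 one_pos) (T - H) hH0.le
    rw [sub_add_cancel] at a1 a2
    have a3 := abs_le.mp (hbound T T hT0 hT4 (by linarith))
    have a4 := abs_le.mp (hbound T (T - H) hT0 (by linarith) (by linarith))
    rw [hpow T hT0] at a3 a4
    have key : ν.real {b | q b ≤ T - H} * H ≤ (μ.real {a | p a ≤ T} + E * H) * H := by
      rw [hE]
      nlinarith [a3.1, a4.2]
    have key2 := le_of_mul_le_mul_right key hH0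
    have hsub : T + -1 * H = T - H := by ring
    rw [hsub, ← rpow_fifteen_sixteenths_div hT0, ← hH]
    have : ν.real {b | q b ≤ T - H} / T ≤ (μ.real {a | p a ≤ T} + E * H) / T := by gcongr
    rw [add_div, mul_div_assoc] at this
    linarith
  · filter_upwards [eventually_ge_atTop 4] with T hT4
    have hT0 : 0 < T := by linarith
    set H := T ^ (15 / 16 : ℝ) with hH
    have hH0 : 0 < H := by positivity
    have hHT : H ≤ T := hHle T (by linarith)
    have a1 := sublevel_mul_le hp one_pos (hμ 1 one_pos) T hH0.le
    have a2 := le_sublevel_mul hq one_pos (hν 1 one_pos) T H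
    have a3 := abs_le.mp (hbound T T hT0 hT4 (by linarith))
    have a4 := abs_le.mp (hbound T (T + H) hT0 (by linarith) (by linarith))
    rw [hpow T hT0] at a3 a4
    have key : μ.real {a | p a ≤ T} * H ≤ (ν.real {b | q b ≤ T + H} + E * H) * H := by
      rw [hE]
      nlinarith [a3.1, a4.2]
    have key2 := le_of_mul_le_mul_right key hH0
    rw [one_mul, ← rpow_fifteen_sixteenths_div hT0, ← hH]
    have : μ.real {a | p a ≤ T} / T ≤ (ν.real {b | q b ≤ T + H} + E * H) / T := by gcongr
    rw [add_div, mul_div_assoc] at this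
    linarith

end Tauberian

/-! ### Dirichlet's divisor problem -/

/-- The pairs `(a, b)` with `(a + 1)(b + 1) ≤ K`. -/
def lambertPairs (K : ℕ) : Finset (ℕ × ℕ) :=
  (Finset.range K ×ˢ Finset.range K).filter fun q => (q.1 + 1) * (q.2 + 1) ≤ K

lemma mem_lambertPairs {K : ℕ} {q : ℕ × ℕ} :
    q ∈ lambertPairs K ↔ (q.1 + 1) * (q.2 + 1) ≤ K := by
  simp only [lambertPairs, Finset.mem_filter, Finset.mem_product, Finset.mem_range,
    and_iff_right_iff_imp]
  intro h
  constructor <;> nlinarith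

lemma card_lambertPairs_filter_fst_lt (K s : ℕ) :
    ((lambertPairs K).filter fun q => q.1 < s).card = ∑ i ∈ Finset.range s, K / (i + 1) := by
  have h : (lambertPairs K).filter (fun q => q.1 < s) =
      ((Finset.range s).sigma fun i => Finset.range (K / (i + 1))).map
        (Equiv.sigmaEquivProd ℕ ℕ).toEmbedding := by
    ext ⟨a, b⟩
    simp only [Finset.mem_filter, mem_lambertPairs, Finset.mem_map_equiv, Finset.mem_sigma,
      Finset.mem_range, Equiv.sigmaEquivProd_symm_apply]
    rw [← Nat.succ_le_iff (m := b), Nat.le_div_iff_mul_le (Nat.succ_pos a), and_comm, mul_comm]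
  rw [h, Finset.card_map, Finset.card_sigma]
  simp

lemma card_lambertPairs_filter_snd_lt (K s : ℕ) :
    ((lambertPairs K).filter fun q => q.2 < s).card =
      ((lambertPairs K).filter fun q => q.1 < s).card := by
  refine Finset.card_bij (fun q _ => q.swap) (fun q hq => ?_) (fun q _ r _ h => Prod.swap_injective h)
    fun q hq => ⟨q.swap, ?_, q.swap_swap⟩
  · simp only [Finset.mem_filter, mem_lambertPairs, Prod.fst_swap, Prod.snd_swap] at hq ⊢
    exact ⟨by rw [mul_comm]; exact hq.1, hq.2⟩
  · simp only [Finset.mem_filter, mem_lambertPairs, Prod.fst_swap, Prod.snd_swap] at hq ⊢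
    exact ⟨by rw [mul_comm]; exact hq.1, hq.2⟩

/-- Dirichlet's hyperbola method. -/
lemma card_lambertPairs_add_sq (K : ℕ) :
    (lambertPairs K).card + K.sqrt ^ 2 = 2 * ∑ i ∈ Finset.range K.sqrt, K / (i + 1) := by
  set s := K.sqrt with hs
  -- Two coordinates ≥ s would force (s + 1)² ≤ K, against the choice of s. The overlap of the two
  -- pieces is the full s × s square, since s² ≤ K.
  have hunion : lambertPairs K =
      ((lambertPairs K).filter fun q => q.1 < s) ∪ (lambertPairs K).filter fun q => q.2 < s := by
    ext q
    simp only [Finset.mem_union, Finset.mem_filter]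
    constructor
    · intro hq
      by_contra! h
      have h1 := h.1 hq
      have h2 := h.2 hq
      have h3 := mem_lambertPairs.mp hq
      have h4 : K < (s + 1) * (s + 1) := Nat.lt_succ_sqrt K
      have := Nat.mul_le_mul (Nat.succ_le_succ h1) (Nat.succ_le_succ h2)
      exact absurd (this.trans h3) (not_le.mpr h4)
    · rintro (h | h) <;> exact h.1
  have hinter : ((lambertPairs K).filter fun q => q.1 < s) ∩
      ((lambertPairs K).filter fun q => q.2 < s) = Finset.range s ×ˢ Finset.range s := by
    ext q
    simp only [Finset.mem_inter, Finset.mem_filter, mem_lambertPairs, Finset.mem_product,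
      Finset.mem_range]
    constructor
    · rintro ⟨⟨-, h1⟩, -, h2⟩
      exact ⟨h1, h2⟩
    · rintro ⟨h1, h2⟩
      have : (q.1 + 1) * (q.2 + 1) ≤ K := (Nat.mul_le_mul h1 h2).trans (Nat.sqrt_le K)
      exact ⟨⟨this, h1⟩, this, h2⟩
  have hcard := Finset.card_union_add_card_inter ((lambertPairs K).filter fun q => q.1 < s)
    ((lambertPairs K).filter fun q => q.2 < s)
  rw [← hunion, hinter, Finset.card_product, Finset.card_range, card_lambertPairs_filter_snd_lt,
    card_lambertPairs_filter_fst_lt] at hcard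
  rw [sq, hcard, two_mul]

lemma floor_sqrt_eq_sqrt_floor {x : ℝ} (hx : 0 ≤ x) : ⌊√x⌋₊ = Nat.sqrt ⌊x⌋₊ := by
  rw [Nat.floor_eq_iff (Real.sqrt_nonneg x)]
  constructor
  · refine Real.le_sqrt_of_sq_le ?_
    have h1 : ((Nat.sqrt ⌊x⌋₊ * Nat.sqrt ⌊x⌋₊ : ℕ) : ℝ) ≤ (⌊x⌋₊ : ℝ) := by
      exact_mod_cast Nat.sqrt_le ⌊x⌋₊
    push_cast at h1
    nlinarith [Nat.floor_le hx]
  · rw [Real.sqrt_lt' (by positivity)]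
    have h1 : ((⌊x⌋₊ + 1 : ℕ) : ℝ) ≤ (((Nat.sqrt ⌊x⌋₊ + 1) * (Nat.sqrt ⌊x⌋₊ + 1) : ℕ) : ℝ) := by
      exact_mod_cast Nat.succ_le_of_lt (Nat.lt_succ_sqrt ⌊x⌋₊)
    push_cast at h1
    nlinarith [Nat.lt_floor_add_one x]

/-- Each quotient is ⌊x/(i + 1)⌋, so dropping the floors costs at most 1 per term. -/
lemma abs_sum_floor_div_sub_le {x : ℝ} (hx : 0 ≤ x) (s : ℕ) :
    |((∑ i ∈ Finset.range s, ⌊x⌋₊ / (i + 1) : ℕ) : ℝ) - x * (harmonic s : ℝ)| ≤ s := by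
  have hH : x * (harmonic s : ℝ) = ∑ i ∈ Finset.range s, x / ((i + 1 : ℕ) : ℝ) := by
    rw [harmonic]
    push_cast
    rw [Finset.mul_sum]
    rfl
  rw [hH]
  push_cast
  rw [← Finset.sum_sub_distrib]
  refine (Finset.abs_sum_le_sum_abs _ _).trans ?_
  have : ∀ i ∈ Finset.range s, |((⌊x⌋₊ / (i + 1) : ℕ) : ℝ) - x / ((i : ℝ) + 1)| ≤ 1 := by
    intro i _
    have h := Nat.floor_div_natCast x (i + 1)
    rw [← h, abs_le]
    push_cast
    have h0 : 0 ≤ x / ((i : ℝ) + 1) := by positivity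
    constructor
    · linarith [Nat.lt_floor_add_one (x / ((i : ℝ) + 1))]
    · linarith [Nat.floor_le h0]
  refine (Finset.sum_le_sum this).trans (le_of_eq ?_)
  simp

/-- Dirichlet's divisor asymptotic. -/
theorem tendsto_card_lambertPairs :
    Tendsto (fun x : ℝ => ((lambertPairs ⌊x⌋₊).card : ℝ) / x - Real.log x) atTop
      (𝓝 (2 * Real.eulerMascheroniConstant - 1)) := by
  have hs : Tendsto (fun x : ℝ => ((⌊√x⌋₊ : ℕ) : ℝ) / √x) atTop (𝓝 1) :=
    (tendsto_nat_floor_div_atTop (R := ℝ)).comp Real.tendsto_sqrt_atTop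
  have hfl : Tendsto (fun x : ℝ => ⌊√x⌋₊) atTop atTop :=
    tendsto_nat_floor_atTop.comp Real.tendsto_sqrt_atTop
  have hharm : Tendsto (fun x : ℝ => (harmonic ⌊√x⌋₊ : ℝ) - Real.log ⌊√x⌋₊) atTop
      (𝓝 Real.eulerMascheroniConstant) := Real.tendsto_harmonic_sub_log.comp hfl
  have hlog : Tendsto (fun x : ℝ => Real.log (((⌊√x⌋₊ : ℕ) : ℝ) / √x)) atTop (𝓝 0) := by
    have := (Real.continuousAt_log one_ne_zero).tendsto.comp hs
    rwa [Real.log_one] at this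
  have hsq : Tendsto (fun x : ℝ => (((⌊√x⌋₊ : ℕ) : ℝ) / √x) ^ 2) atTop (𝓝 1) := by
    simpa using hs.pow 2
  have hsmall : Tendsto (fun x : ℝ => 2 * (((⌊√x⌋₊ : ℕ) : ℝ) / √x * (√x)⁻¹)) atTop (𝓝 0) := by
    simpa using (hs.mul (tendsto_inv_atTop_zero.comp Real.tendsto_sqrt_atTop)).const_mul 2
  -- With s = ⌊√x⌋ the hyperbola count over x is 2H_s - (s/√x)² up to 2s/x. Writing H_s as (H_s -
  -- log s) + log(s/√x) + (log x)/2 isolates log x and leaves the limit 2c - 1.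
  have hmain := ((hharm.const_mul 2).add (hlog.const_mul 2)).sub hsq
  rw [mul_zero, add_zero] at hmain
  have herr : Tendsto (fun x : ℝ => ((lambertPairs ⌊x⌋₊).card : ℝ) / x - Real.log x -
      (2 * ((harmonic ⌊√x⌋₊ : ℝ) - Real.log ⌊√x⌋₊) +
        2 * Real.log (((⌊√x⌋₊ : ℕ) : ℝ) / √x) - (((⌊√x⌋₊ : ℕ) : ℝ) / √x) ^ 2)) atTop (𝓝 0) := by
    refine squeeze_zero_norm' ?_ hsmall
    filter_upwards [eventually_ge_atTop 1] with x hx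
    have hx0 : 0 < x := by linarith
    have hsx : √x ^ 2 = x := Real.sq_sqrt hx0.le
    have hr0 : 0 < √x := Real.sqrt_pos.mpr hx0
    have hfl1 : 1 ≤ ⌊√x⌋₊ := Nat.le_floor (by simpa using Real.one_le_sqrt.mpr hx)
    have hfl0 : (0 : ℝ) < (⌊√x⌋₊ : ℕ) := by exact_mod_cast hfl1
    have hhyp := card_lambertPairs_add_sq ⌊x⌋₊
    rw [← floor_sqrt_eq_sqrt_floor hx0.le] at hhyp
    have hb := abs_sum_floor_div_sub_le hx0.le ⌊√x⌋₊
    have hhyp' : ((lambertPairs ⌊x⌋₊).card : ℝ) + ((⌊√x⌋₊ : ℕ) : ℝ) ^ 2 =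
        2 * ((∑ i ∈ Finset.range ⌊√x⌋₊, ⌊x⌋₊ / (i + 1) : ℕ) : ℝ) := by
      exact_mod_cast hhyp
    set S : ℝ := ((∑ i ∈ Finset.range ⌊√x⌋₊, ⌊x⌋₊ / (i + 1) : ℕ) : ℝ)
    set s : ℝ := ((⌊√x⌋₊ : ℕ) : ℝ)
    have hlogx : Real.log (s / √x) = Real.log s - Real.log x / 2 := by
      rw [Real.log_div hfl0.ne' hr0.ne', Real.log_sqrt hx0.le]
    have heq : ((lambertPairs ⌊x⌋₊).card : ℝ) / x - Real.log x -
        (2 * ((harmonic ⌊√x⌋₊ : ℝ) - Real.log s) + 2 * Real.log (s / √x) - (s / √x) ^ 2) =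
        2 * (S - x * (harmonic ⌊√x⌋₊ : ℝ)) / x := by
      rw [hlogx, div_pow, hsx, eq_sub_of_add_eq hhyp']
      field_simp
      ring
    rw [heq, Real.norm_eq_abs, abs_div, abs_mul, abs_two, abs_of_pos hx0, div_le_iff₀ hx0]
    calc 2 * |S - x * (harmonic ⌊√x⌋₊ : ℝ)| ≤ 2 * s := by gcongr
      _ = 2 * (s / √x * (√x)⁻¹) * √x ^ 2 := by field_simp
      _ = _ := by rw [hsx]
  have := hmain.add herr
  rw [add_zero] at this
  refine this.congr fun x => ?_
  ring

/-! ### The mean square of ζ on the critical line -/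

lemma setOf_two_pi_shiftedProd_le {T : ℝ} (hT : 0 ≤ T) :
    {q : ℕ × ℕ | 2 * Real.pi * shiftedProd q ≤ T} = ↑(lambertPairs ⌊T / (2 * Real.pi)⌋₊) := by
  ext q
  have h2pi : 0 < 2 * Real.pi := by positivity
  rw [Set.mem_ofPred_eq, Finset.mem_coe, mem_lambertPairs, Nat.le_floor_iff (by positivity),
    le_div_iff₀ h2pi, shiftedProd]
  push_cast
  rw [mul_comm]

open MeasureTheory in
/-- The distribution function of the measure `2π ∑ δ_{2πmk}`. -/
theorem tendsto_lambert_measure :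
    Tendsto (fun T : ℝ => (ENNReal.ofReal (2 * Real.pi) • (Measure.count : Measure (ℕ × ℕ))).real
      {q | 2 * Real.pi * shiftedProd q ≤ T} / T - Real.log T) atTop
      (𝓝 (2 * Real.eulerMascheroniConstant - 1 - Real.log (2 * Real.pi))) := by
  have h2pi : 0 < 2 * Real.pi := by positivity
  -- The mass 2π compensates for counting up to T/(2π); only the shift of the logarithm by log 2π
  -- remains.
  have h := (tendsto_card_lambertPairs.comp (tendsto_id.atTop_div_const h2pi)).sub_const
    (Real.log (2 * Real.pi))
  refine h.congr' ?_
  filter_upwards [eventually_gt_atTop 0] with T hT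
  simp only [Function.comp_apply, id]
  rw [setOf_two_pi_shiftedProd_le hT.le, measureReal_ennreal_smul_apply,
    ENNReal.toReal_ofReal h2pi.le, measureReal_def, Measure.count_apply_finset,
    ENNReal.toReal_natCast, Real.log_div hT.ne' h2pi.ne']
  field_simp
  ring

/-- The measure `|ζ(1/2 + it)|² dt` on `t > 1`. -/
noncomputable def zetaMeasure : MeasureTheory.Measure ℝ :=
  (MeasureTheory.volume.restrict (Set.Ioi (1 : ℝ))).withDensity
    fun t => ((‖riemannZeta (1 / 2 + t * Complex.I)‖₊ ^ 2 : NNReal) : ENNReal)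

lemma measurable_nnnorm_riemannZeta_sq :
    Measurable fun t : ℝ => (‖riemannZeta (1 / 2 + t * Complex.I)‖₊ ^ 2 : NNReal) :=
  (continuous_riemannZeta_critical.nnnorm.pow 2).measurable

instance : MeasureTheory.SFinite zetaMeasure := by
  unfold zetaMeasure
  infer_instance

open MeasureTheory in
lemma integrable_exp_zetaMeasure {σ : ℝ} (hσ : 0 < σ) :
    Integrable (fun t : ℝ => Real.exp (-(σ * t))) zetaMeasure := by
  rw [zetaMeasure, integrable_withDensity_iff_integrable_smul measurable_nnnorm_riemannZeta_sq]
  exact integrableOn_riemannZeta_sq_mul_exp hσ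

open MeasureTheory in
lemma integral_cexp_zetaMeasure (δ : ℂ) :
    ∫ t : ℝ, Complex.exp (-(δ * t)) ∂zetaMeasure = zetaLaplace δ := by
  rw [zetaMeasure, integral_withDensity_eq_integral_smul measurable_nnnorm_riemannZeta_sq,
    zetaLaplace]
  refine integral_congr_ae (Eventually.of_forall fun t => ?_)
  simp only [NNReal.smul_def, NNReal.coe_pow, coe_nnnorm, Complex.real_smul]

open MeasureTheory in
lemma zetaMeasure_real_sublevel {T : ℝ} (hT : 1 ≤ T) :
    zetaMeasure.real {t | t ≤ T} = ∫ t in (1 : ℝ)..T, ‖riemannZeta (1 / 2 + t * Complex.I)‖ ^ 2 := by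
  have h := integral_indicator_sublevel (μ := zetaMeasure) (p := fun t : ℝ => t) measurable_id 1 T
  rw [mul_one] at h
  rw [← h, zetaMeasure, integral_withDensity_eq_integral_smul measurable_nnnorm_riemannZeta_sq,
    intervalIntegral.integral_of_le hT, ← Set.Ioi_inter_Iic, Set.inter_comm,
    ← Measure.restrict_restrict measurableSet_Iic, ← integral_indicator measurableSet_Iic]
  refine integral_congr_ae (Eventually.of_forall fun t => ?_)
  simp only
  by_cases ht : t ≤ T
  · rw [Set.indicator_of_mem (show t ∈ {t | t ≤ T} from ht),
      Set.indicator_of_mem (show t ∈ Set.Iic T from ht)]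
    simp [NNReal.smul_def]
  · rw [Set.indicator_of_notMem (show t ∉ {t | t ≤ T} from ht),
      Set.indicator_of_notMem (show t ∉ Set.Iic T from ht), smul_zero]

open MeasureTheory in
lemma integrable_exp_lambert_measure {σ : ℝ} (hσ : 0 < σ) :
    Integrable (fun q : ℕ × ℕ => Real.exp (-(σ * (2 * Real.pi * shiftedProd q))))
      (ENNReal.ofReal (2 * Real.pi) • Measure.count) := by
  refine Integrable.smul_measure ?_ ENNReal.ofReal_ne_top
  rw [integrable_count_iff]
  have := summable_lambert_terms (δ := σ) (by simpa using hσ)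
  simpa using this

open MeasureTheory in
lemma integral_cexp_lambert_measure {δ : ℂ} (h0 : 0 < δ.re) :
    ∫ q : ℕ × ℕ, Complex.exp (-(δ * ((2 * Real.pi * shiftedProd q : ℝ) : ℂ)))
      ∂(ENNReal.ofReal (2 * Real.pi) • Measure.count) = 2 * Real.pi * lambertSeries δ := by
  have hint : Integrable (fun q : ℕ × ℕ =>
      Complex.exp (-(δ * ((2 * Real.pi * shiftedProd q : ℝ) : ℂ)))) Measure.count := by
    rw [integrable_count_iff]
    refine (summable_lambert_terms h0).congr fun q => ?_
    rw [Complex.norm_exp, Complex.neg_re, Complex.re_mul_ofReal]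
  rw [integral_smul_measure, ENNReal.toReal_ofReal (by positivity), integral_countable hint,
    lambertSeries, Complex.real_smul]
  push_cast
  congr 1
  refine tsum_congr fun q => ?_
  simp [measureReal_def]

/-- The mean square of `ζ` on the critical line, with the second-order term. -/
theorem tendsto_mean_square_riemannZeta :
    Tendsto (fun T : ℝ => (∫ t in (1 : ℝ)..T, ‖riemannZeta (1 / 2 + t * Complex.I)‖ ^ 2) / T -
      Real.log T) atTop (𝓝 (2 * Real.eulerMascheroniConstant - 1 - Real.log (2 * Real.pi))) := by
  obtain ⟨C, -, hC⟩ := exists_norm_zetaLaplace_sub_lambertSeries_le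
  have h := tendsto_sublevel_of_laplace_close (μ := zetaMeasure)
    (ν := ENNReal.ofReal (2 * Real.pi) • (MeasureTheory.Measure.count : MeasureTheory.Measure (ℕ × ℕ)))
    (p := fun t : ℝ => t) (q := fun q : ℕ × ℕ => 2 * Real.pi * shiftedProd q) measurable_id
    (measurable_of_countable _) (fun σ hσ => integrable_exp_zetaMeasure hσ)
    (fun σ hσ => integrable_exp_lambert_measure hσ) (C := C) (fun σ hσ hσ4 u => by
      have hre : ((σ : ℂ) + u * Complex.I).re = σ := by simp
      rw [integral_cexp_zetaMeasure, integral_cexp_lambert_measure (by rwa [hre])]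
      have := hC (σ + u * Complex.I) (by rwa [hre]) (by rwa [hre])
      rwa [hre] at this)
    tendsto_lambert_measure
  refine h.congr' ?_
  filter_upwards [eventually_ge_atTop 1] with T hT
  rw [zetaMeasure_real_sublevel hT]

/-! ### The limit Λ_N and Fermat's equation -/

/-- It suffices that c < 2/3 and 4/3 ≤ log 2π; the latter follows from e⁴ < 6³ and π > 3. Positivity
makes the integration endpoints tend to +∞. -/
lemma logModConst_pos : 0 < logModConst := by
  unfold logModConst
  have h1 := Real.eulerMascheroniConstant_lt_two_thirds
  have h2 : (4 / 3 : ℝ) ≤ Real.log (2 * Real.pi) := by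
    rw [Real.le_log_iff_exp_le (by positivity)]
    have h3 : Real.exp (4 / 3) ^ 3 < 6 ^ 3 := by
      rw [← Real.exp_nat_mul]
      have : Real.exp (((3 : ℕ) : ℝ) * (4 / 3)) = Real.exp 1 ^ 4 := by
        rw [← Real.exp_nat_mul]
        norm_num
      rw [this]
      calc Real.exp 1 ^ 4 ≤ 2.7182818286 ^ 4 := by
            gcongr
            exact Real.exp_one_lt_d9.le
        _ < 6 ^ 3 := by norm_num
    have h4 := lt_of_pow_lt_pow_left₀ 3 (by norm_num) h3
    linarith [Real.pi_gt_three]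
  linarith

lemma intervalIntegrable_riemannZeta_sq (a b : ℝ) :
    IntervalIntegrable (fun t : ℝ => ‖riemannZeta (1 / 2 + t * Complex.I)‖ ^ 2)
      MeasureTheory.volume a b :=
  (continuous_riemannZeta_critical.norm.pow 2).intervalIntegrable a b

/-- The limit of the normalized integrals is `N` times the parameter `q`. -/
theorem tendsto_logModMean (N : ℕ) {q : ℝ} (hq : 0 < q) :
    Tendsto (fun τ : ℝ => logModMean N q τ) atTop (𝓝 (N * q)) := by
  have hc := logModConst_pos
  set c := logModConst with hcdef
  set M : ℝ → ℝ := fun T => ∫ t in (1 : ℝ)..T, ‖riemannZeta (1 / 2 + t * Complex.I)‖ ^ 2 with hM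
  -- T log T - T is a primitive of log T, so T log T - T - M(T) = -T (1 + M(T)/T - log T) is
  -- asymptotic to cT, with c here denoting `logModConst`. Evaluating between the two endpoints and
  -- dividing by τ gives (N + 1)q - q.
  have hmean : Tendsto (fun T : ℝ => 1 + (M T / T - Real.log T)) atTop (𝓝 (-c)) := by
    have := tendsto_mean_square_riemannZeta.const_add 1
    convert this using 2
    rw [hcdef, logModConst]
    ring
  have hscale : ∀ k : ℝ, 0 < k → Tendsto (fun τ : ℝ => k * q * (τ / c)) atTop atTop := fun k hk =>
    (tendsto_id.atTop_div_const hc).const_mul_atTop (mul_pos hk hq)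
  have ha := (hmean.comp (hscale 1 one_pos)).const_mul (q / c)
  have hb := (hmean.comp (hscale (N + 1) (by positivity))).const_mul ((N + 1) * q / c)
  have hlim := ha.sub hb
  have heq : q / c * -c - (N + 1) * q / c * -c = N * q := by
    field_simp
    ring
  rw [heq] at hlim
  refine hlim.congr' ?_
  filter_upwards [eventually_gt_atTop 0] with τ hτ
  simp only [Function.comp_apply, logModMean, ← hcdef, logModIntegrand, one_mul]
  have ha0 : 0 < q * (τ / c) := by positivity
  have hb0 : 0 < ((N : ℝ) + 1) * q * (τ / c) := by positivity
  set a := q * (τ / c) with hadef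
  set b := ((N : ℝ) + 1) * q * (τ / c) with hbdef
  rw [intervalIntegral.integral_sub intervalIntegral.intervalIntegrable_log'
    (intervalIntegrable_riemannZeta_sq a b), integral_log,
    ← intervalIntegral.integral_interval_sub_left (intervalIntegrable_riemannZeta_sq 1 b)
      (intervalIntegrable_riemannZeta_sq 1 a)]
  change _ = 1 / τ * (b * Real.log b - a * Real.log a - b + a - (M b - M a))
  have h1 : q / c = a / τ := by rw [hadef]; field_simp
  have h2 : (N + 1) * q / c = b / τ := by rw [hbdef]; field_simp
  rw [h1, h2]
  field_simp
  ring

lemma fermatRational_pos {x y z n : ℕ} (hx : 0 < x) (hz : 0 < z) : 0 < fermatRational x y z n := by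
  unfold fermatRational
  have : (0 : ℝ) < x := by exact_mod_cast hx
  have : (0 : ℝ) < z := by exact_mod_cast hz
  positivity

lemma fermatRational_eq_one_iff {x y z n : ℕ} (hz : 0 < z) :
    fermatRational x y z n = 1 ↔ x ^ n + y ^ n = z ^ n := by
  have h : (0 : ℝ) < (z : ℝ) ^ n := by
    have : (0 : ℝ) < z := by exact_mod_cast hz
    positivity
  rw [fermatRational, div_eq_one_iff_eq h.ne']
  exact_mod_cast Iff.rfl

/-- The limit N q equals N exactly when q = 1. A solution of Fermat's equation has q = 1, the centre
of the window, so it is admissible however small ε is. -/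
theorem corollary2 (N : ℕ) (hN : 1 ≤ N) (ε : ℝ) (hε : 0 < ε) :
    (∀ x y z n : ℕ, LocalFermat N ε x y z n →
      ∃ L : ℝ, Tendsto (fun τ : ℝ => logModMean N (fermatRational x y z n) τ) atTop (𝓝 L)) ∧
    ((∀ x y z n : ℕ, LocalFermat N ε x y z n →
      ¬ Tendsto (fun τ : ℝ => logModMean N (fermatRational x y z n) τ) atTop (𝓝 (N : ℝ))) ↔
      FermatLastTheorem) := by
  have hN0 : (0 : ℝ) < N := by exact_mod_cast hN
  refine ⟨fun x y z n ⟨hx, _, hz, _, _⟩ => ⟨_, tendsto_logModMean N (fermatRational_pos hx hz)⟩,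
    fun h n hn x y z hx hy hz heq => ?_, fun h x y z n ⟨hx, hy, hz, hn, _⟩ hlim => ?_⟩
  · have hx' := Nat.pos_of_ne_zero hx
    have hz' := Nat.pos_of_ne_zero hz
    have hone := (fermatRational_eq_one_iff hz').mpr heq
    have hpos : 0 < ε / N := by positivity
    refine h x y z n ⟨hx', Nat.pos_of_ne_zero hy, hz', hn, ?_⟩ ?_
    · rw [hone]
      constructor <;> linarith
    · simpa [hone] using tendsto_logModMean N (fermatRational_pos (y := y) (n := n) hx' hz')
  · have hu := tendsto_nhds_unique hlim
      (tendsto_logModMean N (fermatRational_pos (y := y) (n := n) hx hz))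
    have hone : fermatRational x y z n = 1 := mul_left_cancel₀ hN0.ne' (by rw [mul_one]; exact hu.symm)
    exact h n hn x y z hx.ne' hy.ne' hz.ne' ((fermatRational_eq_one_iff hz).mp hone)
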